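/- Let $d\ge 1$, let $B_1\subset\mathbb R^d$ be the open unit ball, let $p>1$, and let $\gamma_+,\gamma_-\in\mathbb R$ satisfy $\gamma_+\ge 0$ and $\gamma_++\gamma_->0$. Let $\mathcal S(d)$ be the space of real symmetric $d\times d$ matrices with the operator norm $\|\cdot\|$, and let $F:\mathcal S(d)\to\mathbb R$ be convex and satisfy, for some constants $0<\lambda\le\Lambda$, $$\lambda\|M\|\le F(M)\le\Lambda\|M\|\qquad\text{for every } M\in\mathcal S(d).$$ Let $g\in W^{2,p}(B_1)$ be nonnegative almost everywhere, and let $W^{2,p}_g(B_1)\cap W^{1,p}_g(B_1)$ denote the set of all $u\in W^{2,p}(B_1)$ with $u-g\in W^{1,p}_0(B_1)$. For such $u$ put $$I[u]=\int_{B_1}\Big([F(D^2u)]^p+\gamma_+u^+ +\gamma_-u^-\Big)\,dx,\qquad u^+=\max(u,0),\quad u^-=\max(-u,0)=-\min(u,0).$$ Then the integrand is integrable on $B_1$ for every $u\in W^{2,p}_g(B_1)\cap W^{1,p}_g(B_1)$, and there exists $u^*\in W^{2,p}_g(B_1)\cap W^{1,p}_g(B_1)$ such that $$I[u^*]\le I[u]\qquad\text{for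 all } u\in W^{2,p}_g(B_1)\cap W^{1,p}_g(B_1).$$ -/

import Mathlib

open MeasureTheory Filter Topology
open scoped ContDiff

namespace HessianMin

/-- Euclidean space `ℝ^d`. -/
abbrev E (d : ℕ) : Type := EuclideanSpace ℝ (Fin d)

/-- The space `S(d)` of real symmetric `d × d` matrices. -/
def Sym (d : ℕ) : Submodule ℝ (Matrix (Fin d) (Fin d) ℝ) where
  carrier := {M | M.IsSymm}
  add_mem' := fun ha hb => Matrix.IsSymm.add ha hb
  zero_mem' := Matrix.isSymm_zero
  smul_mem' := fun c _ h => Matrix.IsSymm.smul h c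

/-- The (spectral) norm `‖M‖` of a symmetric matrix: its operator norm on Euclidean space. -/
noncomputable def opNorm {d : ℕ} (M : Sym d) : ℝ :=
  ‖Matrix.toEuclideanCLM (n := Fin d) (𝕜 := ℝ) (M : Matrix (Fin d) (Fin d) ℝ)‖

/-- The open unit ball `B_1` of `ℝ^d`. -/
def unitBall (d : ℕ) : Set (E d) := Metric.ball 0 1

/-- Lebesgue measure on `Ω`. -/
noncomputable def vol {d : ℕ} (Ω : Set (E d)) : Measure (E d) := volume.restrict Ω

/-- Classical partial derivative `∂_i φ`. -/
noncomputable def partialD {d : ℕ} (i : Fin d) (φ : E d → ℝ) (x : E d) : ℝ :=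
  fderiv ℝ φ x (EuclideanSpace.single i 1)

/-- `φ ∈ C_c^∞(Ω)`. -/
structure IsTestFunction {d : ℕ} (Ω : Set (E d)) (φ : E d → ℝ) : Prop where
  smooth : ContDiff ℝ ∞ φ
  compact_support : HasCompactSupport φ
  support_subset : tsupport φ ⊆ Ω

/-- `G` is the weak gradient of `u` in `Ω`. -/
structure HasWeakGradient {d : ℕ} (Ω : Set (E d)) (u : E d → ℝ) (G : E d → E d) : Prop where
  locInt : LocallyIntegrableOn u Ω
  locInt_grad : LocallyIntegrableOn G Ω
  integral_eq : ∀ (i : Fin d) (φ : E d → ℝ), IsTestFunction Ω φ →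
    ∫ x in Ω, u x * partialD i φ x = - ∫ x in Ω, G x i * φ x

/-- `H` is the weak Hessian of `u` in `Ω`: each entry `H_ij` is the weak derivative `D^α u` for the
multi-index `α = e_i + e_j` (so that `H_ij` and `H_ji` are the same derivative). -/
structure HasWeakHessian {d : ℕ} (Ω : Set (E d)) (u : E d → ℝ) (H : E d → Sym d) : Prop where
  locInt : LocallyIntegrableOn u Ω
  locInt_hess : ∀ i j : Fin d, LocallyIntegrableOn (fun x => (H x).1 i j) Ω
  integral_eq : ∀ (i j : Fin d) (φ : E d → ℝ), IsTestFunction Ω φ →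
    ∫ x in Ω, u x * partialD j (partialD i φ) x = ∫ x in Ω, (H x).1 i j * φ x

open Classical in
/-- The weak Hessian `D²u` in `Ω`. It is determined up to equality almost everywhere in `Ω`
whenever it exists (and is given the value zero if it does not). -/
noncomputable def weakHessian {d : ℕ} (Ω : Set (E d)) (u : E d → ℝ) : E d → Sym d :=
  if h : ∃ H, HasWeakHessian Ω u H then h.choose else 0

/-- `u ∈ W^{2,p}(Ω)`: `u` and its weak derivatives of order one and two are in `L^p(Ω)`. -/
structure MemW2p {d : ℕ} (Ω : Set (E d)) (p : ℝ) (u : E d → ℝ) : Prop where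
  memLp : MemLp u (ENNReal.ofReal p) (vol Ω)
  grad : ∃ G : E d → E d, HasWeakGradient Ω u G ∧ MemLp G (ENNReal.ofReal p) (vol Ω)
  hess : ∃ H : E d → Sym d, HasWeakHessian Ω u H ∧
    ∀ i j : Fin d, MemLp (fun x => (H x).1 i j) (ENNReal.ofReal p) (vol Ω)

/-- `v ∈ W_0^{1,p}(Ω)`: `v` lies in the closure of `C_c^∞(Ω)` in `W^{1,p}(Ω)`. -/
def MemW01p {d : ℕ} (Ω : Set (E d)) (p : ℝ) (v : E d → ℝ) : Prop :=
  ∃ G : E d → E d, MemLp v (ENNReal.ofReal p) (vol Ω) ∧ HasWeakGradient Ω v G ∧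
    MemLp G (ENNReal.ofReal p) (vol Ω) ∧
    ∃ φ : ℕ → E d → ℝ, (∀ n, IsTestFunction Ω (φ n)) ∧
      Tendsto (fun n => eLpNorm (fun x => v x - φ n x) (ENNReal.ofReal p) (vol Ω)) atTop (𝓝 0) ∧
      Tendsto (fun n => eLpNorm (fun x => G x - gradient (φ n) x) (ENNReal.ofReal p) (vol Ω))
        atTop (𝓝 0)

/-- `u ∈ W^{2,p}_g(Ω) ∩ W^{1,p}_g(Ω)`: `u ∈ W^{2,p}(Ω)` and `u` has boundary values `g` in the sense
that `u - g ∈ W_0^{1,p}(Ω)`. -/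
def Admissible {d : ℕ} (Ω : Set (E d)) (p : ℝ) (g u : E d → ℝ) : Prop :=
  MemW2p Ω p u ∧ MemW01p Ω p (fun x => u x - g x)

/-- The integrand `[F(D²u)]^p + γ₊ max(u, 0) - γ₋ min(u, 0)`. -/
noncomputable def density {d : ℕ} (F : Sym d → ℝ) (p γp γm : ℝ) (u : E d → ℝ) (x : E d) : ℝ :=
  F (weakHessian (unitBall d) u x) ^ p + γp * max (u x) 0 - γm * min (u x) 0

/-- The functional `I[u] = ∫_{B_1} [F(D²u)]^p + γ₊ max(u, 0) - γ₋ min(u, 0)`. -/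
noncomputable def energy {d : ℕ} (F : Sym d → ℝ) (p γp γm : ℝ) (u : E d → ℝ) : ℝ :=
  ∫ x in unitBall d, density F p γp γm u x

end HessianMin

/-!
The energy is convex even when `γ₋` is negative, since
`γ₊ u⁺ + γ₋ u⁻ = (γ₊ + γ₋) u⁺ - γ₋ u` and `γ₊ + γ₋ > 0`. A minimizer is found by the direct method,
with strong instead of weak convergence.

Convexity provides strong convergence (`exists_minimizing_seq_midpoint_gap`): among the functions
whose energy is within `1/n` of the infimum, a convex set, choose one which almost minimizes
`∑ ‖∂ᵢⱼu‖_p^p`. Midpoints of chosen functions remain competitors, so they cannot have a noticeably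
smaller value of this quantity. By the uniform convexity of `L^p`, which follows from the pointwise
inequality `exists_abs_sub_rpow_le`, the Hessians of the chosen sequence are Cauchy in `L^p`
(`tendsto_hessNorm_sub`).

The functions and their gradients then converge as well, because of the second order Poincaré
inequality `‖v‖_p + ‖∇v‖_p ≤ C ‖D²v‖_p` for `v` in `W^{2,p} ∩ W_0^{1,p}`
(`exists_eLpNorm_le_hessNorm`), applied to differences of admissible functions. It combines the
Friedrichs inequality in `W_0^{1,p}` with the Poincaré–Wirtinger inequality for the components of
`∇v`, whose integrals vanish. The latter is proved for smooth functions by integration along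
segments and transferred to Sobolev functions by mollification in the interior.

The same inequality gives coercivity (`NormLike.exists_integral_rpow_le_energy`): `‖u‖₁` grows at
most linearly in `‖F(D²u)‖_p`, while the leading term of the energy is the `p`-th power of this
quantity and `p > 1`. Finally, a convex `F` of linear growth is Lipschitz
(`sub_le_of_convex_of_le_opNorm`), so the energy passes to the limit along strongly convergent
sequences (`NormLike.energy_le_of_tendsto`).
-/

namespace HessianMin

open scoped ENNReal Convolution

/-! ### Convexity inequalities and minimizing sequences -/

theorem abs_half_add_rpow_lt {p : ℝ} (hp : 1 < p) {a b : ℝ} (hab : a ≠ b) :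
    |(a + b) / 2| ^ p < (|a| ^ p + |b| ^ p) / 2 := by
  have hp0 : 0 < p := by linarith
  by_cases h : |a| = |b|
  · have hb : b = -a := by
      rcases abs_eq_abs.1 h with h | h
      · exact absurd h hab
      · linarith
    have ha : a ≠ 0 := by
      rintro rfl
      exact hab (by simpa using hb.symm)
    have : 0 < |a| ^ p := Real.rpow_pos_of_pos (abs_pos.2 ha) _
    have h0 : |(a + b) / 2| = 0 := by rw [hb]; simp
    rw [h0, ← h, Real.zero_rpow hp0.ne']
    linarith
  · have h1 : |(a + b) / 2| ≤ (1 / 2 : ℝ) * |a| + (1 / 2) * |b| := by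
      rw [abs_div, abs_two]
      linarith [abs_add_le a b]
    have h2 := (strictConvexOn_rpow hp).2 (abs_nonneg a) (abs_nonneg b) h
      (by norm_num : (0 : ℝ) < 1 / 2) (by norm_num : (0 : ℝ) < 1 / 2) (by norm_num)
    simp only [smul_eq_mul] at h2
    have h3 := Real.rpow_le_rpow (abs_nonneg _) h1 hp0.le
    linarith

/-- A quantitative form of the strict convexity of `|·|^p`, which gives uniform convexity of `L^p`
after integration. By homogeneity it suffices to consider `max |a| |b| = 1`, and there it follows
by compactness. -/
theorem exists_abs_sub_rpow_le {p : ℝ} (hp : 1 < p) {ε : ℝ} (hε : 0 < ε) :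
    ∃ C : ℝ, 0 ≤ C ∧ ∀ a b : ℝ, |a - b| ^ p ≤
      ε * (|a| ^ p + |b| ^ p) + C * ((|a| ^ p + |b| ^ p) / 2 - |(a + b) / 2| ^ p) := by
  have hp0 : 0 < p := by linarith
  have hcont : ∀ f : ℝ × ℝ → ℝ, Continuous f → Continuous fun z => |f z| ^ p := fun f hf =>
    hf.abs.rpow_const fun _ => Or.inr hp0.le
  have hc1 := hcont (fun z => z.1) continuous_fst
  have hc2 := hcont (fun z => z.2) continuous_snd
  have hc3 := hcont (fun z => z.1 - z.2) (by fun_prop)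
  have hc4 := hcont (fun z => (z.1 + z.2) / 2) (by fun_prop)
  let K : Set (ℝ × ℝ) := {z | max |z.1| |z.2| = 1 ∧ ε * (|z.1| ^ p + |z.2| ^ p) ≤ |z.1 - z.2| ^ p}
  have hKc : IsCompact K := by
    apply Metric.isCompact_of_isClosed_isBounded
    · apply IsClosed.inter
      · exact isClosed_eq (by fun_prop) continuous_const
      · exact isClosed_le (continuous_const.mul (hc1.add hc2)) hc3
    · refine (Metric.isBounded_closedBall (x := (0 : ℝ × ℝ)) (r := 1)).subset fun z hz => ?_
      rw [mem_closedBall_zero_iff, Prod.norm_def]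
      exact hz.1.le
  let ψ : ℝ × ℝ → ℝ := fun z => (|z.1| ^ p + |z.2| ^ p) / 2 - |(z.1 + z.2) / 2| ^ p
  have hψ0 : ∀ z, 0 ≤ ψ z := by
    intro z
    by_cases h : z.1 = z.2
    · simp only [ψ, h]; simp
    · exact sub_nonneg.2 (abs_half_add_rpow_lt hp h).le
  obtain ⟨δ, hδ, hδK⟩ : ∃ δ : ℝ, 0 < δ ∧ ∀ z ∈ K, δ ≤ ψ z := by
    rcases K.eq_empty_or_nonempty with hK | hK
    · exact ⟨1, one_pos, by simp [hK]⟩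
    · obtain ⟨z, hz, hmin⟩ := hKc.exists_isMinOn hK
        ((((hc1.add hc2).div_const 2).sub hc4).continuousOn : ContinuousOn ψ K)
      refine ⟨ψ z, ?_, fun w hw => hmin hw⟩
      apply sub_pos.2 (abs_half_add_rpow_lt hp _)
      intro heq
      have h1 := hz.1
      have h2 := hz.2
      rw [heq, sub_self, abs_zero, Real.zero_rpow hp0.ne'] at h2
      rw [heq, max_self] at h1
      rw [h1, Real.one_rpow] at h2
      linarith
  have key : ∀ z : ℝ × ℝ, max |z.1| |z.2| = 1 →
      |z.1 - z.2| ^ p ≤ ε * (|z.1| ^ p + |z.2| ^ p) + 2 ^ p / δ * ψ z := by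
    intro z hz
    have hsum : 0 ≤ |z.1| ^ p + |z.2| ^ p := by positivity
    by_cases hK : z ∈ K
    · have h1 : |z.1 - z.2| ^ p ≤ 2 ^ p := by
        apply Real.rpow_le_rpow (abs_nonneg _) _ hp0.le
        have := abs_sub z.1 z.2
        have := le_max_left |z.1| |z.2|
        have := le_max_right |z.1| |z.2|
        linarith
      have h2 : 2 ^ p ≤ 2 ^ p / δ * ψ z := by
        rw [div_mul_eq_mul_div, le_div_iff₀ hδ]
        exact mul_le_mul_of_nonneg_left (hδK z hK) (by positivity)
      have : 0 ≤ ε * (|z.1| ^ p + |z.2| ^ p) := by positivity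
      linarith
    · have h1 : |z.1 - z.2| ^ p < ε * (|z.1| ^ p + |z.2| ^ p) := by
        by_contra hcon
        exact hK ⟨hz, not_lt.1 hcon⟩
      have : 0 ≤ 2 ^ p / δ * ψ z := mul_nonneg (by positivity) (hψ0 z)
      linarith
  refine ⟨2 ^ p / δ, by positivity, fun a b => ?_⟩
  set s := max |a| |b| with hs
  have hs0 : 0 ≤ s := le_max_of_le_left (abs_nonneg a)
  rcases hs0.eq_or_lt with h0 | hpos
  · have ha : a = 0 := abs_eq_zero.1 (le_antisymm ((le_max_left _ _).trans h0.symm.le) (abs_nonneg a))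
    have hb : b = 0 := abs_eq_zero.1 (le_antisymm ((le_max_right _ _).trans h0.symm.le) (abs_nonneg b))
    simp [ha, hb, Real.zero_rpow hp0.ne']
  · have hk := key (a / s, b / s) (by
      simp only [abs_div, abs_of_pos hpos]
      rw [max_div_div_right hpos.le, ← hs, div_self hpos.ne'])
    have e : ∀ x : ℝ, |x| ^ p = s ^ p * |x / s| ^ p := by
      intro x
      rw [← Real.mul_rpow hs0 (abs_nonneg _), abs_div, abs_of_pos hpos, mul_div_cancel₀ _ hpos.ne']
    have e1 : a / s - b / s = (a - b) / s := by ring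
    have e2 : (a / s + b / s) / 2 = ((a + b) / 2) / s := by ring
    simp only [ψ, e1, e2] at hk
    rw [e (a - b), e a, e b, e ((a + b) / 2)]
    have := mul_le_mul_of_nonneg_left hk (by positivity : 0 ≤ s ^ p)
    linarith

theorem exists_mul_le_half_rpow_add {p : ℝ} (hp : 1 < p) (c : ℝ) :
    ∃ K : ℝ, 0 ≤ K ∧ ∀ x : ℝ, 0 ≤ x → c * x ≤ x ^ p / 2 + K := by
  set c' := max c 1 with hc'
  have hc1 : 1 ≤ c' := le_max_right _ _
  set T : ℝ := (2 * c') ^ (1 / (p - 1)) with hT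
  have hp1 : 0 < p - 1 := by linarith
  have hT0 : 0 < T := by positivity
  have hTp : T ^ (p - 1) = 2 * c' := by
    rw [hT, ← Real.rpow_mul (by positivity), one_div_mul_cancel hp1.ne', Real.rpow_one]
  refine ⟨c' * T, by positivity, fun x hx => ?_⟩
  have hcx : c * x ≤ c' * x := mul_le_mul_of_nonneg_right (le_max_left _ _) hx
  have hxp : 0 ≤ x ^ p := Real.rpow_nonneg hx p
  rcases le_total x T with h | h
  · have : c' * x ≤ c' * T := by gcongr
    linarith
  · have hx0 : 0 < x := hT0.trans_le h
    have h1 : 2 * c' ≤ x ^ (p - 1) := hTp ▸ Real.rpow_le_rpow hT0.le h hp1.le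
    have h2 : x ^ p = x ^ (p - 1) * x := by
      rw [← Real.rpow_add_one hx0.ne', sub_add_cancel]
    have h3 := mul_le_mul_of_nonneg_right h1 hx
    have : 0 ≤ c' * T := by positivity
    linarith

/-- Abstract selection of a minimizing sequence. Among almost minimizers of the (midpoint convex)
functional `I`, those which also almost minimize a second functional `N` have midpoints for which
`N` shows no gap asymptotically. When `N` is a power of a uniformly convex norm, the
sequence is therefore Cauchy, and no weak compactness is needed. -/
theorem exists_minimizing_seq_midpoint_gap {X : Type*} [Nonempty X] (mid : X → X → X) (I N : X → ℝ)
    (hI : ∀ a b, I (mid a b) ≤ (I a + I b) / 2) (hIb : BddBelow (Set.range I))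
    (hN0 : ∀ a, 0 ≤ N a) (hN : ∀ c, ∃ R, ∀ a, I a ≤ c → N a ≤ R) :
    ∃ u : ℕ → X, Tendsto (fun n => I (u n)) atTop (𝓝 (⨅ a, I a)) ∧
      ∀ ε > 0, ∃ k, ∀ n ≥ k, ∀ m ≥ k, (N (u n) + N (u m)) / 2 - N (mid (u n) (u m)) < ε := by
  set μ := ⨅ a, I a with hμ
  let δ : ℕ → ℝ := fun n => 1 / ((n : ℝ) + 1)
  have hδ0 : ∀ n, 0 < δ n := fun n => Nat.one_div_pos_of_nat
  have hδt : Tendsto δ atTop (𝓝 0) := tendsto_one_div_add_atTop_nhds_zero_nat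
  have hδm : ∀ {n m : ℕ}, n ≤ m → δ m ≤ δ n := fun h => Nat.one_div_le_one_div h
  let S : ℕ → Set ℝ := fun n => N '' {a | I a ≤ μ + δ n}
  have hSb : ∀ n, BddBelow (S n) := fun n => ⟨0, by rintro _ ⟨a, -, rfl⟩; exact hN0 a⟩
  have hSn : ∀ n, (S n).Nonempty := by
    intro n
    obtain ⟨a, ha⟩ := exists_lt_of_ciInf_lt (show (⨅ a, I a) < μ + δ n by linarith [hδ0 n])
    exact ⟨N a, a, ha.le, rfl⟩
  -- The infima of `N` over the shrinking sublevel sets of `I` increase to a finite limit.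
  let r : ℕ → ℝ := fun n => sInf (S n)
  have hrm : Monotone r := fun n m h => csInf_le_csInf (hSb n) (hSn m)
    (Set.image_mono fun a (ha : I a ≤ _) => ha.trans (by linarith [hδm h]))
  obtain ⟨R, hR⟩ := hN (μ + 1)
  have hrb : BddAbove (Set.range r) := by
    refine ⟨R, ?_⟩
    rintro _ ⟨n, rfl⟩
    obtain ⟨_, a, ha, rfl⟩ := hSn n
    refine (csInf_le (hSb n) ⟨a, ha, rfl⟩).trans (hR a ?_)
    have : δ n ≤ δ 0 := hδm n.zero_le
    have h0 : δ 0 = 1 := by simp [δ]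
    have ha' : I a ≤ μ + δ n := ha
    linarith
  have hrt := tendsto_atTop_ciSup hrm hrb
  set ρ := ⨆ n, r n
  have hex : ∀ n, ∃ a, I a ≤ μ + δ n ∧ N a < r n + δ n := by
    intro n
    obtain ⟨_, ⟨a, ha, rfl⟩, hlt⟩ := exists_lt_of_csInf_lt (hSn n)
      (show sInf (S n) < r n + δ n by linarith [hδ0 n])
    exact ⟨a, ha, hlt⟩
  choose u hu1 hu2 using hex
  refine ⟨u, ?_, ?_⟩
  · refine tendsto_of_tendsto_of_tendsto_of_le_of_le tendsto_const_nhds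
      (by simpa using tendsto_const_nhds.add hδt) (fun n => ciInf_le hIb _) hu1
  · intro ε hε
    obtain ⟨k₁, hk₁⟩ := Metric.tendsto_atTop.1 hrt (ε / 2) (by positivity)
    obtain ⟨k₂, hk₂⟩ := Metric.tendsto_atTop.1 hδt (ε / 2) (by positivity)
    refine ⟨max k₁ k₂, fun n hn m hm => ?_⟩
    set k := max k₁ k₂
    have hmid : r k ≤ N (mid (u n) (u m)) := by
      refine csInf_le (hSb k) ⟨_, ?_, rfl⟩
      have h1 := hI (u n) (u m)
      have h2 := hu1 n
      have h3 := hu1 m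
      have h4 := hδm hn
      have h5 := hδm hm
      show I _ ≤ _
      linarith
    have a1 := (abs_lt.1 (hk₁ k (le_max_left _ _))).1
    have a2 := (abs_lt.1 (hk₂ k (le_max_right _ _))).2
    have b1 : r n ≤ ρ := le_ciSup hrb n
    have b2 : r m ≤ ρ := le_ciSup hrb m
    have c1 := hu2 n
    have c2 := hu2 m
    have h4 := hδm hn
    have h5 := hδm hm
    linarith

/-! ### Integral inequalities for smooth functions -/

/-- Jensen's inequality for the `p`-th power, without normalization of the measure. -/
theorem rpow_lintegral_le {α : Type*} [MeasurableSpace α] {μ : Measure α} {p : ℝ} (hp : 1 < p)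
    {f : α → ℝ≥0∞} (hf : AEMeasurable f μ) :
    (∫⁻ x, f x ∂μ) ^ p ≤ μ Set.univ ^ (p - 1) * ∫⁻ x, f x ^ p ∂μ := by
  have hp0 : 0 < p := by linarith
  have hpq : p.HolderConjugate (p / (p - 1)) := Real.HolderConjugate.conjExponent hp
  have h := ENNReal.lintegral_mul_le_Lp_mul_Lq μ hpq hf (aemeasurable_const (b := (1 : ℝ≥0∞)))
  simp only [Pi.mul_apply, mul_one, ENNReal.one_rpow, lintegral_one] at h
  refine (ENNReal.rpow_le_rpow h hp0.le).trans (le_of_eq ?_)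
  rw [ENNReal.mul_rpow_of_nonneg _ _ hp0.le, ← ENNReal.rpow_mul, ← ENNReal.rpow_mul,
    one_div_mul_cancel hp0.ne', ENNReal.rpow_one, mul_comm]
  congr 2
  field_simp

theorem rpow_sum_le {ι : Type*} [Fintype ι] {p : ℝ} (hp : 1 < p) (a : ι → ℝ≥0∞) :
    (∑ i, a i) ^ p ≤ (Fintype.card ι : ℝ≥0∞) ^ (p - 1) * ∑ i, a i ^ p := by
  let _ : MeasurableSpace ι := ⊤
  have h := rpow_lintegral_le (μ := Measure.count) hp (f := a) (measurable_from_top).aemeasurable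
  simpa [lintegral_count, tsum_fintype, Measure.count_univ] using h

theorem enorm_sub_rpow_le_lintegral_segment {d : ℕ} {p : ℝ} (hp : 1 < p) {f : E d → ℝ}
    (hf : ContDiff ℝ 1 f) (x y : E d) :
    ‖f x - f y‖ₑ ^ p ≤
      ‖x - y‖ₑ ^ p * ∫⁻ t in Set.Ioc (0 : ℝ) 1, ‖fderiv ℝ f (y + t • (x - y))‖ₑ ^ p := by
  have hp0 : 0 < p := by linarith
  have hderiv : ∀ t : ℝ, HasDerivAt (fun t : ℝ => f (y + t • (x - y)))
      (fderiv ℝ f (y + t • (x - y)) (x - y)) t := by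
    intro t
    have h1 : HasDerivAt (fun t : ℝ => y + t • (x - y)) (x - y) t := by
      simpa using ((hasDerivAt_id t).smul_const (x - y)).const_add y
    exact ((hf.differentiable one_ne_zero _).hasFDerivAt).comp_hasDerivAt t h1
  have hcd : Continuous fun t : ℝ => fderiv ℝ f (y + t • (x - y)) :=
    (hf.continuous_fderiv one_ne_zero).comp (by fun_prop)
  have hc : Continuous fun t : ℝ => fderiv ℝ f (y + t • (x - y)) (x - y) :=
    hcd.clm_apply continuous_const
  have hftc := intervalIntegral.integral_eq_sub_of_hasDerivAt (a := 0) (b := 1)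
    (fun t _ => hderiv t) (hc.intervalIntegrable 0 1)
  have h1 : ‖f x - f y‖ₑ ≤
      ∫⁻ t in Set.Ioc (0 : ℝ) 1, ‖fderiv ℝ f (y + t • (x - y))‖ₑ * ‖x - y‖ₑ := by
    have : f x - f y = ∫ t in Set.Ioc (0 : ℝ) 1, fderiv ℝ f (y + t • (x - y)) (x - y) := by
      rw [← intervalIntegral.integral_of_le zero_le_one, hftc]
      simp
    rw [this]
    refine (enorm_integral_le_lintegral_enorm _).trans (lintegral_mono fun t => ?_)
    exact ContinuousLinearMap.le_opENorm _ _
  refine (ENNReal.rpow_le_rpow h1 hp0.le).trans ?_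
  refine (rpow_lintegral_le hp ?_).trans (le_of_eq ?_)
  · exact (hcd.enorm.measurable.mul_const _).aemeasurable
  · simp only [ENNReal.mul_rpow_of_nonneg _ _ hp0.le]
    rw [lintegral_mul_const _ (hcd.enorm.measurable.pow_const p)]
    simp [mul_comm]

/-- The Friedrichs inequality for test functions on the unit ball: `φ` vanishes at `x - 2 e` for
`x` in the ball and `e` a unit vector, so that `φ x` is an integral of `∇φ` over a segment. -/
theorem IsTestFunction.lintegral_rpow_le {d : ℕ} (hd : 0 < d) {p : ℝ} (hp : 1 < p) {φ : E d → ℝ}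
    (hφ : IsTestFunction (unitBall d) φ) :
    ∫⁻ x, ‖φ x‖ₑ ^ p ≤ 2 ^ p * ∫⁻ x, ‖fderiv ℝ φ x‖ₑ ^ p := by
  have hp0 : 0 < p := by linarith
  have h1 : ContDiff ℝ 1 φ := hφ.smooth.of_le (by exact_mod_cast le_top)
  have hcd : Continuous (fderiv ℝ φ) := h1.continuous_fderiv one_ne_zero
  have hzero : ∀ x, x ∉ unitBall d → φ x = 0 := fun x hx =>
    image_eq_zero_of_notMem_tsupport fun h => hx (hφ.support_subset h)
  let e : E d := EuclideanSpace.single ⟨0, hd⟩ (2 : ℝ)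
  have he : ‖e‖ = 2 := by simp [e]
  have hpt : ∀ x, ‖φ x‖ₑ ^ p ≤
      2 ^ p * ∫⁻ t in Set.Ioc (0 : ℝ) 1, ‖fderiv ℝ φ (x - e + t • e)‖ₑ ^ p := by
    intro x
    by_cases hx : x ∈ unitBall d
    · have h0 : φ (x - e) = 0 := by
        apply hzero
        rw [unitBall, mem_ball_zero_iff] at hx ⊢
        have := norm_sub_norm_le e x
        rw [norm_sub_rev] at this
        linarith
      have h := enorm_sub_rpow_le_lintegral_segment hp h1 x (x - e)
      rw [h0, sub_zero, sub_sub_cancel] at h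
      have he' : ‖e‖ₑ = 2 := by rw [← ofReal_norm, he]; simp
      rwa [he'] at h
    · simp [hzero x hx, hp0]
  calc ∫⁻ x, ‖φ x‖ₑ ^ p
      ≤ ∫⁻ x, 2 ^ p * ∫⁻ t in Set.Ioc (0 : ℝ) 1, ‖fderiv ℝ φ (x - e + t • e)‖ₑ ^ p :=
        lintegral_mono hpt
    _ = 2 ^ p * ∫⁻ x, ∫⁻ t in Set.Ioc (0 : ℝ) 1, ‖fderiv ℝ φ (x - e + t • e)‖ₑ ^ p :=
        lintegral_const_mul' _ _ (by simp [ENNReal.rpow_eq_top_iff])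
    _ = 2 ^ p * ∫⁻ t in Set.Ioc (0 : ℝ) 1, ∫⁻ x, ‖fderiv ℝ φ (x - e + t • e)‖ₑ ^ p := by
        congr 1
        refine lintegral_lintegral_swap (Measurable.aemeasurable ?_)
        have : Continuous fun z : E d × ℝ => fderiv ℝ φ (z.1 - e + z.2 • e) :=
          hcd.comp (by fun_prop)
        exact this.enorm.measurable.pow_const p
    _ = 2 ^ p * ∫⁻ t in Set.Ioc (0 : ℝ) 1, ∫⁻ x, ‖fderiv ℝ φ x‖ₑ ^ p := by
        congr 1
        refine lintegral_congr fun t => ?_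
        have : ∀ x, x - e + t • e = x + (t • e - e) := fun x => by abel
        simp only [this]
        exact lintegral_add_right_eq_self (fun x => ‖fderiv ℝ φ x‖ₑ ^ p) _
    _ = 2 ^ p * ∫⁻ x, ‖fderiv ℝ φ x‖ₑ ^ p := by simp

/-- Contracting a convex set towards one of its points `y` by a factor `t ≥ 1/2` increases
integrals by at most the factor `2 ^ d`. -/
theorem lintegral_convex_comb_le {d : ℕ} {S : Set (E d)} (hS : MeasurableSet S)
    (hSc : Convex ℝ S) {h : E d → ℝ≥0∞} (hh : Measurable h) {t : ℝ} (ht : 1 / 2 ≤ t) (ht1 : t ≤ 1)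
    {y : E d} (hy : y ∈ S) :
    ∫⁻ x in S, h (t • x + (1 - t) • y) ≤ 2 ^ d * ∫⁻ x in S, h x := by
  have ht0 : 0 < t := by linarith
  have hk : Measurable (S.indicator h) := hh.indicator hS
  calc ∫⁻ x in S, h (t • x + (1 - t) • y)
      = ∫⁻ x in S, S.indicator h (t • x + (1 - t) • y) := by
        refine setLIntegral_congr_fun hS fun x hx => ?_
        have : t • x + (1 - t) • y ∈ S := hSc hx hy ht0.le (by linarith) (by ring)
        exact (Set.indicator_of_mem this h).symm
    _ ≤ ∫⁻ x, S.indicator h (t • x + (1 - t) • y) := setLIntegral_le_lintegral _ _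
    _ = ∫⁻ x, S.indicator h (x + (1 - t) • y) ∂(Measure.map (t • ·) volume) :=
        (lintegral_map (f := fun x => S.indicator h (x + (1 - t) • y))
          (hk.comp (measurable_add_const _)) (measurable_const_smul t)).symm
    _ = ENNReal.ofReal |(t ^ d)⁻¹| * ∫⁻ x, S.indicator h x := by
        rw [Measure.map_addHaar_smul volume ht0.ne', lintegral_smul_measure,
          lintegral_add_right_eq_self, finrank_euclideanSpace_fin, smul_eq_mul]
    _ ≤ 2 ^ d * ∫⁻ x in S, h x := by
        rw [lintegral_indicator hS]
        gcongr
        rw [abs_of_pos (by positivity), ← inv_pow, ENNReal.ofReal_pow (by positivity)]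
        gcongr
        rw [show (2 : ℝ≥0∞) = ENNReal.ofReal 2 by simp]
        apply ENNReal.ofReal_le_ofReal
        rw [inv_le_comm₀ ht0 two_pos]
        linarith

/-- The Poincaré inequality for `C¹` functions on a ball, in the form of a bound for the double
integral of differences. Each difference is an integral of the derivative over a segment; of the
two end points of the segment, the one which is further from the current point is kept fixed. -/
theorem lintegral_lintegral_enorm_sub_rpow_le {d : ℕ} {p : ℝ} (hp : 1 < p) {f : E d → ℝ}
    (hf : ContDiff ℝ 1 f) {S : Set (E d)} (hS : MeasurableSet S) (hSc : Convex ℝ S)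
    (hSb : S ⊆ unitBall d) :
    ∫⁻ x in S, ∫⁻ y in S, ‖f x - f y‖ₑ ^ p ≤
      2 ^ p * (2 ^ d * volume (unitBall d)) * ∫⁻ x in S, ‖fderiv ℝ f x‖ₑ ^ p := by
  have hp0 : 0 < p := by linarith
  have h2p : (2 : ℝ≥0∞) ^ p ≠ ⊤ := by simp [ENNReal.rpow_eq_top_iff]
  have hcd : Continuous (fderiv ℝ f) := hf.continuous_fderiv one_ne_zero
  set h : E d → ℝ≥0∞ := fun z => ‖fderiv ℝ f z‖ₑ ^ p with hh
  have hm : Measurable h := hcd.enorm.measurable.pow_const p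
  have hvol : volume S ≤ volume (unitBall d) := measure_mono hSb
  have hslice : ∀ t ∈ Set.Ioc (0 : ℝ) 1, ∫⁻ x in S, ∫⁻ y in S, h (y + t • (x - y)) ≤
      2 ^ d * volume (unitBall d) * ∫⁻ x in S, h x := by
    intro t ht
    have hconst : ∫⁻ _ in S, 2 ^ d * ∫⁻ x in S, h x ≤
        2 ^ d * volume (unitBall d) * ∫⁻ x in S, h x := by
      rw [lintegral_const, Measure.restrict_apply_univ, mul_right_comm]
      gcongr
    rcases le_total (1 / 2) t with h2 | h2
    · rw [lintegral_lintegral_swap]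
      · refine le_trans (setLIntegral_mono' hS fun y hy => ?_) hconst
        convert lintegral_convex_comb_le hS hSc hm h2 ht.2 hy using 4 with x
        rw [smul_sub, sub_smul, one_smul]; abel
      · exact (hm.comp (Continuous.measurable (by fun_prop : Continuous fun z : E d × E d =>
          z.2 + t • (z.1 - z.2)))).aemeasurable
    · refine le_trans (setLIntegral_mono' hS fun x hx => ?_) hconst
      convert lintegral_convex_comb_le hS hSc hm (by linarith : 1 / 2 ≤ 1 - t)
        (by linarith [ht.1]) hx using 4 with y
      rw [smul_sub, sub_smul, one_smul, sub_sub_cancel]; abel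
  calc ∫⁻ x in S, ∫⁻ y in S, ‖f x - f y‖ₑ ^ p
      ≤ ∫⁻ x in S, ∫⁻ y in S, 2 ^ p * ∫⁻ t in Set.Ioc (0 : ℝ) 1, h (y + t • (x - y)) := by
        refine setLIntegral_mono' hS fun x hx => setLIntegral_mono' hS fun y hy => ?_
        refine (enorm_sub_rpow_le_lintegral_segment hp hf x y).trans ?_
        gcongr
        have hx1 := hSb hx
        have hy1 := hSb hy
        rw [unitBall, mem_ball_zero_iff] at hx1 hy1
        rw [← ofReal_norm]
        refine ENNReal.ofReal_le_of_le_toReal ?_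
        rw [ENNReal.toReal_ofNat]
        linarith [norm_sub_le x y]
    _ = 2 ^ p * ∫⁻ x in S, ∫⁻ y in S, ∫⁻ t in Set.Ioc (0 : ℝ) 1, h (y + t • (x - y)) := by
        simp only [lintegral_const_mul' _ _ h2p]
    _ = 2 ^ p * ∫⁻ x in S, ∫⁻ t in Set.Ioc (0 : ℝ) 1, ∫⁻ y in S, h (y + t • (x - y)) := by
        congr 1
        refine lintegral_congr fun x => lintegral_lintegral_swap ?_
        exact (hm.comp (Continuous.measurable (by fun_prop : Continuous fun z : E d × ℝ =>
          z.1 + z.2 • (x - z.1)))).aemeasurable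
    _ = 2 ^ p * ∫⁻ t in Set.Ioc (0 : ℝ) 1, ∫⁻ x in S, ∫⁻ y in S, h (y + t • (x - y)) := by
        congr 1
        refine lintegral_lintegral_swap (Measurable.aemeasurable ?_)
        have hq : Measurable fun z : (E d × ℝ) × E d => h (z.2 + z.1.2 • (z.1.1 - z.2)) :=
          hm.comp (Continuous.measurable (by fun_prop))
        exact hq.lintegral_prod_right'
    _ ≤ 2 ^ p * ∫⁻ _ in Set.Ioc (0 : ℝ) 1, 2 ^ d * volume (unitBall d) * ∫⁻ x in S, h x := by
        exact mul_le_mul_right (setLIntegral_mono' measurableSet_Ioc hslice) _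
    _ = 2 ^ p * (2 ^ d * volume (unitBall d)) * ∫⁻ x in S, ‖fderiv ℝ f x‖ₑ ^ p := by
        rw [lintegral_const]
        simp [hh, mul_assoc]

theorem norm_le_sum_norm_apply_single {d : ℕ} (L : E d →L[ℝ] ℝ) :
    ‖L‖ ≤ ∑ i, ‖L (EuclideanSpace.single i 1)‖ := by
  refine L.opNorm_le_bound (by positivity) fun x => ?_
  have hx : x = ∑ i, x i • EuclideanSpace.single i (1 : ℝ) := by
    ext j
    simp [Finset.sum_apply, Pi.single_apply]
  conv_lhs => rw [hx, map_sum]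
  refine (norm_sum_le _ _).trans ?_
  rw [Finset.sum_mul]
  refine Finset.sum_le_sum fun i _ => ?_
  rw [map_smul, norm_smul, mul_comm]
  gcongr
  exact PiLp.norm_apply_le x i

theorem enorm_fderiv_rpow_le {d : ℕ} {p : ℝ} (hp : 1 < p) (f : E d → ℝ) (x : E d) :
    ‖fderiv ℝ f x‖ₑ ^ p ≤ (d : ℝ≥0∞) ^ (p - 1) * ∑ i, ‖partialD i f x‖ₑ ^ p := by
  have h1 : ‖fderiv ℝ f x‖ₑ ≤ ∑ i, ‖partialD i f x‖ₑ := by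
    simp only [← ofReal_norm]
    rw [← ENNReal.ofReal_sum_of_nonneg fun _ _ => norm_nonneg _]
    exact ENNReal.ofReal_le_ofReal (norm_le_sum_norm_apply_single _)
  refine (ENNReal.rpow_le_rpow h1 (by linarith)).trans ?_
  simpa using rpow_sum_le hp fun i => ‖partialD i f x‖ₑ

/-! ### Mollification and the Poincaré–Wirtinger inequality -/

/-- The mollification of a function on the unit ball, extended by zero, with a bump function. -/
noncomputable def mollify {d : ℕ} (φ : ContDiffBump (0 : E d)) (w : E d → ℝ) : E d → ℝ :=
  φ.normed volume ⋆[ContinuousLinearMap.lsmul ℝ ℝ, volume] (unitBall d).indicator w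

theorem measurableSet_unitBall (d : ℕ) : MeasurableSet (unitBall d) := measurableSet_ball

theorem contDiff_mollify {d : ℕ} (φ : ContDiffBump (0 : E d)) {w : E d → ℝ}
    (hw : IntegrableOn w (unitBall d)) : ContDiff ℝ 1 (mollify φ w) :=
  φ.hasCompactSupport_normed.contDiff_convolution_left _ (φ.contDiff_normed (n := 1))
    (hw.integrable_indicator (measurableSet_unitBall d)).locallyIntegrable

theorem mollify_apply {d : ℕ} (φ : ContDiffBump (0 : E d)) (w : E d → ℝ) (x : E d) :
    mollify φ w x = ∫ y in unitBall d, φ.normed volume (x - y) * w y := by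
  rw [mollify, convolution_eq_swap, ← integral_indicator (measurableSet_unitBall d)]
  congr 1 with y
  by_cases hy : y ∈ unitBall d <;> simp [hy]

theorem isTestFunction_normed_sub {d : ℕ} (φ : ContDiffBump (0 : E d)) {x : E d}
    (hx : ‖x‖ + φ.rOut < 1) :
    IsTestFunction (unitBall d) fun y => φ.normed volume (x - y) := by
  have hsupp : tsupport (fun y => φ.normed volume (x - y)) ⊆ Metric.closedBall x φ.rOut := by
    refine closure_minimal (fun y hy => ?_) Metric.isClosed_closedBall
    have h1 : x - y ∈ Function.support (φ.normed volume) := hy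
    rw [φ.support_normed_eq, mem_ball_zero_iff] at h1
    rw [mem_closedBall_iff_norm, norm_sub_rev]
    exact h1.le
  refine ⟨(φ.contDiff_normed (n := ⊤)).comp (contDiff_const.sub contDiff_id), ?_, ?_⟩
  · exact HasCompactSupport.intro (isCompact_closedBall x φ.rOut) fun y hy =>
      image_eq_zero_of_notMem_tsupport (f := fun y => φ.normed volume (x - y)) fun h =>
        hy (hsupp h)
  · refine hsupp.trans fun y hy => ?_
    rw [mem_closedBall_iff_norm] at hy
    rw [unitBall, mem_ball_zero_iff]
    have := norm_le_norm_add_norm_sub' y x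
    linarith

/-- Away from the boundary, mollification commutes with weak differentiation. -/
theorem partialD_mollify {d : ℕ} (φ : ContDiffBump (0 : E d)) {w D : E d → ℝ} {i : Fin d}
    (hw : IntegrableOn w (unitBall d))
    (hD : ∀ ψ, IsTestFunction (unitBall d) ψ →
      ∫ x in unitBall d, w x * partialD i ψ x = - ∫ x in unitBall d, D x * ψ x)
    {x : E d} (hx : ‖x‖ + φ.rOut < 1) : partialD i (mollify φ w) x = mollify φ D x := by
  have hg : LocallyIntegrable ((unitBall d).indicator w) volume :=
    (hw.integrable_indicator (measurableSet_unitBall d)).locallyIntegrable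
  have hη1 : ContDiff ℝ 1 (φ.normed (volume : Measure (E d))) := φ.contDiff_normed (n := 1)
  have hηc : HasCompactSupport (φ.normed (volume : Measure (E d))) := φ.hasCompactSupport_normed
  have hfd := (hηc.hasFDerivAt_convolution_left (ContinuousLinearMap.lsmul ℝ ℝ) hη1 hg x).fderiv
  have hex := (hηc.fderiv ℝ).convolutionExists_left
    ((ContinuousLinearMap.lsmul ℝ ℝ).precompL (E d)) (hη1.continuous_fderiv one_ne_zero) hg x
  have hex' := hex.integrable_swap
  have hpart : ∀ y, partialD i (fun y => φ.normed volume (x - y)) y =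
      - fderiv ℝ (φ.normed volume) (x - y) (EuclideanSpace.single i 1) := by
    intro y
    have h1 : HasFDerivAt (fun y => φ.normed volume (x - y))
        ((fderiv ℝ (φ.normed volume) (x - y)).comp (-ContinuousLinearMap.id ℝ (E d))) y :=
      (hη1.differentiable one_ne_zero _).hasFDerivAt.comp y ((hasFDerivAt_id y).const_sub x)
    rw [partialD, h1.fderiv]
    simp
  rw [partialD, mollify, hfd, convolution_eq_swap,
    ContinuousLinearMap.integral_apply hex', mollify_apply]
  have h := hD _ (isTestFunction_normed_sub φ hx)
  simp only [hpart, mul_neg, integral_neg, neg_inj] at h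
  simp_rw [mul_comm (φ.normed volume _)]
  rw [← h, ← integral_indicator (measurableSet_unitBall d)]
  congr 1 with y
  rw [ContinuousLinearMap.precompL_apply]
  by_cases hy : y ∈ unitBall d <;> simp [hy, mul_comm]

/-- Mollification does not increase the `L^p` norm, by Jensen's inequality for the averages. -/
theorem lintegral_mollify_rpow_le {d : ℕ} {p : ℝ} (hp : 1 < p) (φ : ContDiffBump (0 : E d))
    {D : E d → ℝ} (hD : AEMeasurable D (volume.restrict (unitBall d))) :
    ∫⁻ x, ‖mollify φ D x‖ₑ ^ p ≤ ∫⁻ x in unitBall d, ‖D x‖ₑ ^ p := by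
  have hp0 : 0 < p := by linarith
  set η : E d → ℝ≥0∞ := fun z => ‖φ.normed (volume : Measure (E d)) z‖ₑ with hη
  have hηm : Measurable η := φ.continuous_normed.enorm.measurable
  have hη1 : ∫⁻ z, η z = 1 := by
    have h := ofReal_integral_eq_lintegral_ofReal (φ.integrable_normed (μ := volume))
      (ae_of_all _ φ.nonneg_normed)
    rw [φ.integral_normed, ENNReal.ofReal_one] at h
    rw [h]
    exact lintegral_congr fun z => Real.enorm_of_nonneg (φ.nonneg_normed z)
  have hpt : ∀ x, ‖mollify φ D x‖ₑ ^ p ≤ ∫⁻ y in unitBall d, η (x - y) * ‖D y‖ₑ ^ p := by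
    intro x
    have hηx : Measurable fun y => η (x - y) := hηm.comp (measurable_const_sub x)
    -- The averaging measure of the mollification at `x`; its mass is less than `1` near the boundary.
    set ν := (volume.restrict (unitBall d)).withDensity fun y => η (x - y) with hν
    have hac : ν ≪ volume.restrict (unitBall d) := withDensity_absolutelyContinuous _ _
    have hν1 : ν Set.univ ≤ 1 := by
      rw [hν, withDensity_apply _ MeasurableSet.univ, Measure.restrict_univ]
      refine (setLIntegral_le_lintegral _ _).trans ?_
      rw [lintegral_sub_left_eq_self η x, hη1]
    have h1 : ‖mollify φ D x‖ₑ ≤ ∫⁻ y, ‖D y‖ₑ ∂ν := by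
      rw [mollify_apply, hν, lintegral_withDensity_eq_lintegral_mul₀ hηx.aemeasurable hD.enorm]
      refine (enorm_integral_le_lintegral_enorm _).trans (le_of_eq ?_)
      simp [η, enorm_mul]
    refine (ENNReal.rpow_le_rpow h1 hp0.le).trans ?_
    refine (rpow_lintegral_le hp (hD.enorm.mono_ac hac)).trans ?_
    rw [hν, lintegral_withDensity_eq_lintegral_mul₀ hηx.aemeasurable (hD.enorm.pow_const p)]
    calc _ ≤ 1 * ∫⁻ y in unitBall d, η (x - y) * ‖D y‖ₑ ^ p := by
          gcongr
          · exact ENNReal.rpow_le_one hν1 (by linarith)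
          · exact le_of_eq rfl
      _ = _ := one_mul _
  calc ∫⁻ x, ‖mollify φ D x‖ₑ ^ p
      ≤ ∫⁻ x, ∫⁻ y in unitBall d, η (x - y) * ‖D y‖ₑ ^ p := lintegral_mono hpt
    _ = ∫⁻ y in unitBall d, ∫⁻ x, η (x - y) * ‖D y‖ₑ ^ p := by
        refine lintegral_lintegral_swap ?_
        have h1 : AEMeasurable (fun z : E d × E d => ‖D z.2‖ₑ ^ p)
            (volume.prod (volume.restrict (unitBall d))) :=
          (hD.enorm.pow_const p).comp_snd
        exact (hηm.comp (measurable_fst.sub measurable_snd)).aemeasurable.mul h1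
    _ = ∫⁻ y in unitBall d, ‖D y‖ₑ ^ p := by
        refine lintegral_congr fun y => ?_
        have hm : Measurable fun x => η (x - y) := hηm.comp (measurable_sub_const y)
        rw [lintegral_mul_const _ hm, lintegral_sub_right_eq_self η y, hη1, one_mul]

/-- The Poincaré–Wirtinger inequality on the unit ball, for functions with weak partial derivatives
in the interior. It is obtained from the smooth case by mollification on smaller concentric balls
and Fatou's lemma. -/
theorem lintegral_lintegral_enorm_sub_rpow_le_of_weak {d : ℕ} {p : ℝ} (hp : 1 < p) {w : E d → ℝ}
    {D : Fin d → E d → ℝ} (hw : IntegrableOn w (unitBall d))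
    (hDi : ∀ i, IntegrableOn (D i) (unitBall d))
    (hD : ∀ i ψ, IsTestFunction (unitBall d) ψ →
      ∫ x in unitBall d, w x * partialD i ψ x = - ∫ x in unitBall d, D i x * ψ x) :
    ∫⁻ x in unitBall d, ∫⁻ y in unitBall d, ‖w x - w y‖ₑ ^ p ≤
      2 ^ p * (2 ^ d * volume (unitBall d)) *
        (d ^ (p - 1) * ∑ i, ∫⁻ x in unitBall d, ‖D i x‖ₑ ^ p) := by
  have hp0 : 0 < p := by linarith
  let r : ℕ → ℝ := fun n => 1 / ((n : ℝ) + 1)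
  have hr0 : ∀ n, 0 < r n := fun n => Nat.one_div_pos_of_nat
  have hrt : Tendsto r atTop (𝓝 0) := tendsto_one_div_add_atTop_nhds_zero_nat
  let φ : ℕ → ContDiffBump (0 : E d) := fun n =>
    ⟨r n / 2, r n, half_pos (hr0 n), half_lt_self (hr0 n)⟩
  let S : ℕ → Set (E d) := fun n => Metric.ball 0 (1 - r n)
  have hSB : ∀ n, S n ⊆ unitBall d := fun n => Metric.ball_subset_ball (by linarith [hr0 n])
  have hSm : ∀ n, MeasurableSet (S n) := fun n => measurableSet_ball
  set μ := (volume : Measure (E d)).restrict (unitBall d) with hμ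
  let f : ℕ → E d → ℝ := fun n => mollify (φ n) w
  have hf : ∀ n, ContDiff ℝ 1 (f n) := fun n => contDiff_mollify (φ n) hw
  let Φ : ℕ → E d × E d → ℝ≥0∞ := fun n =>
    (S n ×ˢ S n).indicator fun z => ‖f n z.1 - f n z.2‖ₑ ^ p
  have hcont : ∀ n, Continuous fun z : E d × E d => f n z.1 - f n z.2 := fun n =>
    ((hf n).continuous.comp continuous_fst).sub ((hf n).continuous.comp continuous_snd)
  have hΦm : ∀ n, Measurable (Φ n) := fun n =>
    ((hcont n).enorm.measurable.pow_const p).indicator ((hSm n).prod (hSm n))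
  have hae : ∀ᵐ x ∂μ, x ∈ unitBall d ∧ Tendsto (fun n => f n x) atTop (𝓝 (w x)) := by
    have h := ContDiffBump.ae_convolution_tendsto_right_of_locallyIntegrable (φ := φ) (K := 2)
      (μ := volume) hrt (Eventually.of_forall fun n => by simp [φ]; linarith)
      (hw.integrable_indicator (measurableSet_unitBall d)).locallyIntegrable
    filter_upwards [ae_restrict_of_ae h, ae_restrict_mem (measurableSet_unitBall d)] with x hx hxB
    rw [Set.indicator_of_mem hxB] at hx
    exact ⟨hxB, hx⟩
  have hwm : AEMeasurable w μ := hw.aemeasurable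
  have hev : ∀ x ∈ unitBall d, ∀ᶠ n in atTop, x ∈ S n := by
    intro x hx
    rw [unitBall, mem_ball_zero_iff] at hx
    filter_upwards [hrt.eventually (gt_mem_nhds (show (0 : ℝ) < 1 - ‖x‖ by linarith))] with n hn
    rw [mem_ball_zero_iff]
    linarith
  have hlim : ∀ᵐ z ∂(μ.prod μ),
      ‖w z.1 - w z.2‖ₑ ^ p ≤ liminf (fun n => Φ n z) atTop := by
    have h1 : ∀ᵐ z ∂(μ.prod μ), z.1 ∈ unitBall d ∧ Tendsto (fun n => f n z.1) atTop (𝓝 (w z.1)) :=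
      Measure.quasiMeasurePreserving_fst.ae hae
    have h2 : ∀ᵐ z ∂(μ.prod μ), z.2 ∈ unitBall d ∧ Tendsto (fun n => f n z.2) atTop (𝓝 (w z.2)) :=
      Measure.quasiMeasurePreserving_snd.ae hae
    filter_upwards [h1, h2] with z hz1 hz2
    have ht : Tendsto (fun n => ‖f n z.1 - f n z.2‖ₑ ^ p) atTop (𝓝 (‖w z.1 - w z.2‖ₑ ^ p)) :=
      ((hz1.2.sub hz2.2).enorm).ennrpow_const p
    refine le_of_eq (Tendsto.liminf_eq (ht.congr' ?_)).symm
    filter_upwards [hev _ hz1.1, hev _ hz2.1] with n h1 h2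
    have hmem : z ∈ S n ×ˢ S n := ⟨h1, h2⟩
    exact (Set.indicator_of_mem hmem fun z => ‖f n z.1 - f n z.2‖ₑ ^ p).symm
  have hbound : ∀ n, ∫⁻ z, Φ n z ∂(μ.prod μ) ≤
      2 ^ p * (2 ^ d * volume (unitBall d)) *
        (d ^ (p - 1) * ∑ i, ∫⁻ x, ‖D i x‖ₑ ^ p ∂μ) := by
    intro n
    have hrestr : (μ.prod μ).restrict (S n ×ˢ S n) =
        (volume.restrict (S n)).prod (volume.restrict (S n)) := by
      rw [← Measure.prod_restrict, hμ, Measure.restrict_restrict (hSm n),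
        Set.inter_eq_left.2 (hSB n)]
    rw [lintegral_indicator ((hSm n).prod (hSm n)), hrestr,
      lintegral_prod _ ((hcont n).enorm.measurable.pow_const p).aemeasurable]
    refine (lintegral_lintegral_enorm_sub_rpow_le hp (hf n) (hSm n) (convex_ball _ _)
      (hSB n)).trans ?_
    refine mul_le_mul_right ?_ _
    calc ∫⁻ x in S n, ‖fderiv ℝ (f n) x‖ₑ ^ p
        ≤ ∫⁻ x in S n, d ^ (p - 1) * ∑ i, ‖mollify (φ n) (D i) x‖ₑ ^ p := by
          refine setLIntegral_mono' (hSm n) fun x hx => ?_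
          refine (enorm_fderiv_rpow_le hp (f n) x).trans (le_of_eq ?_)
          congr 1
          refine Finset.sum_congr rfl fun i _ => ?_
          rw [partialD_mollify (φ n) hw (hD i)]
          rw [mem_ball_zero_iff] at hx
          show ‖x‖ + r n < 1
          linarith
      _ ≤ ∫⁻ x, d ^ (p - 1) * ∑ i, ‖mollify (φ n) (D i) x‖ₑ ^ p := setLIntegral_le_lintegral _ _
      _ = d ^ (p - 1) * ∑ i, ∫⁻ x, ‖mollify (φ n) (D i) x‖ₑ ^ p := by
          have hm : ∀ i, Measurable fun x => ‖mollify (φ n) (D i) x‖ₑ ^ p := fun i =>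
            (contDiff_mollify (φ n) (hDi i)).continuous.enorm.measurable.pow_const p
          rw [lintegral_const_mul _ (Finset.measurable_fun_sum _ fun i _ => hm i),
            lintegral_finsetSum _ fun i _ => hm i]
      _ ≤ d ^ (p - 1) * ∑ i, ∫⁻ x, ‖D i x‖ₑ ^ p ∂μ := by
          refine mul_le_mul_right (Finset.sum_le_sum fun i _ => ?_) _
          exact lintegral_mollify_rpow_le hp (φ n) ((hDi i).aemeasurable)
  have hpm : AEMeasurable (fun z : E d × E d => ‖w z.1 - w z.2‖ₑ ^ p) (μ.prod μ) :=
    (hwm.comp_fst.sub hwm.comp_snd).enorm.pow_const p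
  rw [← lintegral_prod _ hpm]
  refine (lintegral_mono_ae hlim).trans ?_
  refine (lintegral_liminf_le hΦm).trans ?_
  refine (liminf_le_liminf (Eventually.of_forall hbound)).trans ?_
  simp

/-! ### Convergence in `L^p` -/

instance instIsFiniteMeasureVolUnitBall (d : ℕ) : IsFiniteMeasure (vol (unitBall d)) :=
  isFiniteMeasure_restrict.2 measure_ball_lt_top.ne

theorem one_le_ofReal {p : ℝ} (hp : 1 < p) : 1 ≤ ENNReal.ofReal p :=
  ENNReal.one_le_ofReal.2 hp.le

theorem eLpNorm_ofReal_eq {α ε : Type*} [MeasurableSpace α] [NormedAddCommGroup ε]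
    {μ : Measure α} {p : ℝ} (hp : 1 < p) (f : α → ε) :
    eLpNorm f (ENNReal.ofReal p) μ = (∫⁻ x, ‖f x‖ₑ ^ p ∂μ) ^ (1 / p) := by
  have hp0 : 0 < p := by linarith
  rw [eLpNorm_eq_lintegral_rpow_enorm_toReal (by simpa using hp0) ENNReal.ofReal_ne_top,
    ENNReal.toReal_ofReal hp0.le]

theorem eLpNorm_ofReal_rpow {α ε : Type*} [MeasurableSpace α] [NormedAddCommGroup ε]
    {μ : Measure α} {p : ℝ} (hp : 1 < p) (f : α → ε) :
    eLpNorm f (ENNReal.ofReal p) μ ^ p = ∫⁻ x, ‖f x‖ₑ ^ p ∂μ := by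
  rw [eLpNorm_ofReal_eq hp, ← ENNReal.rpow_mul, one_div_mul_cancel (by linarith), ENNReal.rpow_one]

theorem exists_eLpNorm_one_le_mul {α ε : Type*} [MeasurableSpace α] [NormedAddCommGroup ε]
    (μ : Measure α) [IsFiniteMeasure μ] {q : ℝ≥0∞} (hq : 1 ≤ q) :
    ∃ C : ℝ≥0∞, C ≠ ⊤ ∧ ∀ f : α → ε, AEStronglyMeasurable f μ →
      eLpNorm f 1 μ ≤ eLpNorm f q μ * C := by
  refine ⟨_, ?_, fun f hf => eLpNorm_le_eLpNorm_mul_rpow_measure_univ hq hf⟩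
  refine ENNReal.rpow_ne_top_of_nonneg ?_ (measure_ne_top _ _)
  rcases eq_or_ne q ⊤ with rfl | hqt
  · simp
  · have : 1 ≤ q.toReal := by
      rw [← ENNReal.toReal_one]; exact ENNReal.toReal_mono hqt hq
    simp only [ENNReal.toReal_one, div_one, sub_nonneg]
    exact (div_le_one (by linarith)).2 this

theorem tendsto_eLpNorm_one_of_tendsto_eLpNorm {α ε ι : Type*} [MeasurableSpace α]
    [NormedAddCommGroup ε] {μ : Measure α} [IsFiniteMeasure μ] {q : ℝ≥0∞} (hq : 1 ≤ q)
    {l : Filter ι} {f : ι → α → ε} (hf : ∀ n, AEStronglyMeasurable (f n) μ)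
    (h : Tendsto (fun n => eLpNorm (f n) q μ) l (𝓝 0)) :
    Tendsto (fun n => eLpNorm (f n) 1 μ) l (𝓝 0) := by
  obtain ⟨C, hC, hle⟩ := exists_eLpNorm_one_le_mul (ε := ε) μ hq
  have h2 := ENNReal.Tendsto.mul_const h (Or.inr hC)
  rw [zero_mul] at h2
  exact tendsto_of_tendsto_of_tendsto_of_le_of_le tendsto_const_nhds h2 (fun _ => zero_le)
    fun n => hle _ (hf n)

/-- On a finite measure space, `L^q` convergence implies convergence of the integrals against any
bounded function. -/
theorem tendsto_integral_mul_of_tendsto_eLpNorm {α : Type*} [MeasurableSpace α]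
    {μ : Measure α} [IsFiniteMeasure μ] {q : ℝ≥0∞} (hq : 1 ≤ q) {f : ℕ → α → ℝ} {f' ψ : α → ℝ}
    (hf : ∀ n, MemLp (f n) q μ) (hf' : MemLp f' q μ)
    (h : Tendsto (fun n => eLpNorm (fun x => f n x - f' x) q μ) atTop (𝓝 0))
    (hψ : AEStronglyMeasurable ψ μ) {M : ℝ} (hM : ∀ x, ‖ψ x‖ ≤ M) :
    Tendsto (fun n => ∫ x, f n x * ψ x ∂μ) atTop (𝓝 (∫ x, f' x * ψ x ∂μ)) := by
  have hint : ∀ {g : α → ℝ}, MemLp g q μ → Integrable (fun x => g x * ψ x) μ := fun hg =>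
    (hg.integrable hq).mul_bdd hψ (ae_of_all _ hM)
  refine tendsto_integral_of_L1' _ (hint hf').aestronglyMeasurable
    (Eventually.of_forall fun n => hint (hf n)) ?_
  have h1 := tendsto_eLpNorm_one_of_tendsto_eLpNorm hq (fun n => ((hf n).sub hf').1) h
  have h2 := ENNReal.Tendsto.const_mul h1 (Or.inr (ENNReal.ofReal_ne_top (r := M)))
  rw [mul_zero] at h2
  refine tendsto_of_tendsto_of_tendsto_of_le_of_le tendsto_const_nhds h2 (fun _ => zero_le)
    fun n => ?_
  refine eLpNorm_le_mul_eLpNorm_of_ae_le_mul (ae_of_all _ fun x => ?_) 1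
  rw [Pi.sub_apply, ← sub_mul, norm_mul, mul_comm]
  exact mul_le_mul_of_nonneg_right (hM x) (norm_nonneg _)

theorem exists_tendsto_eLpNorm_of_cauchy {α ε : Type*} [MeasurableSpace α]
    [NormedAddCommGroup ε] [CompleteSpace ε] {μ : Measure α} {q : ℝ≥0∞} (hq : 1 ≤ q)
    {f : ℕ → α → ε} (hf : ∀ n, MemLp (f n) q μ)
    (hc : Tendsto (fun k : ℕ × ℕ => eLpNorm (fun x => f k.1 x - f k.2 x) q μ) atTop (𝓝 0)) :
    ∃ f' : α → ε, MemLp f' q μ ∧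
      Tendsto (fun n => eLpNorm (fun x => f n x - f' x) q μ) atTop (𝓝 0) := by
  have : Fact (1 ≤ q) := ⟨hq⟩
  have hcs : CauchySeq fun n => (hf n).toLp (f n) := by
    rw [Lp.cauchySeq_Lp_iff_cauchySeq_eLpNorm]
    refine hc.congr fun k => eLpNorm_congr_ae ?_
    filter_upwards [(hf k.1).coeFn_toLp, (hf k.2).coeFn_toLp] with x h1 h2
    simp [h1, h2]
  obtain ⟨F, hF⟩ := cauchySeq_tendsto_of_complete hcs
  refine ⟨F, Lp.memLp F, ?_⟩
  rw [Lp.tendsto_Lp_iff_tendsto_eLpNorm'] at hF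
  refine hF.congr fun n => eLpNorm_congr_ae ?_
  filter_upwards [(hf n).coeFn_toLp] with x h1
  simp [h1]

/-! ### Test functions and weak derivatives on the unit ball -/

variable {d : ℕ} {p : ℝ}

theorem partialD_contDiff {φ : E d → ℝ} (hφ : ContDiff ℝ ∞ φ) (i : Fin d) :
    ContDiff ℝ ∞ (partialD i φ) :=
  (hφ.fderiv_right (m := ∞) (by exact_mod_cast le_top)).clm_apply contDiff_const

theorem IsTestFunction.partialDeriv {Ω : Set (E d)} {φ : E d → ℝ} (hφ : IsTestFunction Ω φ)
    (i : Fin d) : IsTestFunction Ω (partialD i φ) :=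
  ⟨partialD_contDiff hφ.smooth i, hφ.compact_support.fderiv_apply ℝ _,
    (tsupport_fderiv_apply_subset ℝ _).trans hφ.support_subset⟩

theorem IsTestFunction.eq_zero {Ω : Set (E d)} {φ : E d → ℝ} (hφ : IsTestFunction Ω φ)
    {x : E d} (hx : x ∉ Ω) : φ x = 0 :=
  image_eq_zero_of_notMem_tsupport fun h => hx (hφ.support_subset h)

theorem IsTestFunction.exists_bound {Ω : Set (E d)} {φ : E d → ℝ} (hφ : IsTestFunction Ω φ) :
    ∃ M, ∀ x, ‖φ x‖ ≤ M :=
  hφ.compact_support.exists_bound_of_continuous hφ.smooth.continuous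

theorem IsTestFunction.integrable_mul {Ω : Set (E d)} {φ f : E d → ℝ} (hφ : IsTestFunction Ω φ)
    (hf : LocallyIntegrableOn f Ω) : Integrable (fun x => f x * φ x) (volume.restrict Ω) := by
  have h1 : IntegrableOn (fun x => f x * φ x) (tsupport φ) volume :=
    (hf.integrableOn_compact_subset hφ.support_subset hφ.compact_support).mul_continuousOn
      hφ.smooth.continuous.continuousOn hφ.compact_support
  have h2 : Integrable (fun x => f x * φ x) volume := by
    refine (integrableOn_iff_integrable_of_support_subset fun x hx => ?_).1 h1
    exact subset_tsupport φ fun h => hx (by simp [h])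
  exact h2.restrict

theorem IsTestFunction.linComb {Ω : Set (E d)} {φ ψ : E d → ℝ} (hφ : IsTestFunction Ω φ)
    (hψ : IsTestFunction Ω ψ) (a b : ℝ) : IsTestFunction Ω fun x => a * φ x + b * ψ x := by
  refine ⟨(contDiff_const.mul hφ.smooth).add (contDiff_const.mul hψ.smooth),
    (hφ.compact_support.mul_left).add hψ.compact_support.mul_left, ?_⟩
  have h1 : tsupport (fun x => a * φ x) ⊆ Ω := tsupport_mul_subset_right.trans hφ.support_subset
  have h2 : tsupport (fun x => b * ψ x) ⊆ Ω := tsupport_mul_subset_right.trans hψ.support_subset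
  exact (tsupport_add _ _).trans (Set.union_subset h1 h2)

theorem gradient_apply (φ : E d → ℝ) (x : E d) (i : Fin d) :
    gradient φ x i = partialD i φ x := by
  have h : inner ℝ (gradient φ x) (EuclideanSpace.single i (1 : ℝ)) = partialD i φ x := by
    rw [gradient, InnerProductSpace.toDual_symm_apply, partialD]
  rw [← h, EuclideanSpace.inner_single_right]
  simp

theorem enorm_gradient (φ : E d → ℝ) (x : E d) : ‖gradient φ x‖ₑ = ‖fderiv ℝ φ x‖ₑ := by
  rw [gradient, ← ofReal_norm, LinearIsometryEquiv.norm_map, ofReal_norm]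

theorem gradient_linComb {φ ψ : E d → ℝ} (hφ : ContDiff ℝ ∞ φ) (hψ : ContDiff ℝ ∞ ψ)
    (a b : ℝ) (x : E d) :
    gradient (fun x => a * φ x + b * ψ x) x = a • gradient φ x + b • gradient ψ x := by
  have h1 := (hφ.differentiable (by simp) x).hasFDerivAt.const_mul a
  have h2 := (hψ.differentiable (by simp) x).hasFDerivAt.const_mul b
  have h3 : HasFDerivAt (fun x => a * φ x + b * ψ x) _ x := h1.add h2
  rw [gradient, h3.fderiv, map_add, map_smulₛₗ, map_smulₛₗ]
  simp [gradient]

/-- Uniqueness of weak derivatives. -/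
theorem ae_eq_of_integral_test_eq {Ω : Set (E d)} (hΩ : IsOpen Ω) {f f' : E d → ℝ}
    (hf : LocallyIntegrableOn f Ω) (hf' : LocallyIntegrableOn f' Ω)
    (h : ∀ φ, IsTestFunction Ω φ → ∫ x in Ω, f x * φ x = ∫ x in Ω, f' x * φ x) :
    f =ᵐ[vol Ω] f' := by
  have h0 : ∀ᵐ x, x ∈ Ω → f x - f' x = 0 := by
    refine hΩ.ae_eq_zero_of_integral_contDiff_smul_eq_zero (hf.sub hf') fun φ h1 h2 h3 => ?_
    have hφ : IsTestFunction Ω φ := ⟨h1, h2, h3⟩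
    have h4 : ∫ x, φ x • (f x - f' x) = ∫ x in Ω, φ x • (f x - f' x) := by
      refine (setIntegral_eq_integral_of_forall_compl_eq_zero fun x hx => ?_).symm
      rw [hφ.eq_zero hx, zero_smul]
    have h5 : ∀ x, φ x • (f x - f' x) = f x * φ x - f' x * φ x := fun x => by
      rw [smul_eq_mul]; ring
    rw [h4]
    simp only [h5]
    rw [integral_sub (hφ.integrable_mul hf) (hφ.integrable_mul hf'), h φ hφ, sub_self]
  have h1 : ∀ᵐ x ∂(volume.restrict Ω), f x - f' x = 0 :=
    (ae_restrict_iff' hΩ.measurableSet).2 h0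
  exact h1.mono fun x hx => sub_eq_zero.1 hx

theorem isOpen_unitBall (d : ℕ) : IsOpen (unitBall d) := Metric.isOpen_ball

theorem HasWeakHessian.ae_eq {Ω : Set (E d)} (hΩ : IsOpen Ω) {u : E d → ℝ} {H H' : E d → Sym d}
    (h : HasWeakHessian Ω u H) (h' : HasWeakHessian Ω u H') : H =ᵐ[vol Ω] H' := by
  have : ∀ᵐ x ∂(vol Ω), ∀ i j, (H x).1 i j = (H' x).1 i j := by
    rw [ae_all_iff]; intro i
    rw [ae_all_iff]; intro j
    refine ae_eq_of_integral_test_eq hΩ (h.locInt_hess i j) (h'.locInt_hess i j) fun φ hφ => ?_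
    rw [← h.integral_eq i j φ hφ, h'.integral_eq i j φ hφ]
  exact this.mono fun x hx => Subtype.ext (Matrix.ext hx)

theorem norm_coord_le (x : E d) (i : Fin d) : ‖x i‖ ≤ ‖x‖ := PiLp.norm_apply_le x i

theorem norm_le_sum_norm_coord (x : E d) : ‖x‖ ≤ ∑ i, ‖x i‖ := by
  have hx : x = ∑ i, EuclideanSpace.single i (x i) := by
    ext j
    simp [Finset.sum_apply, Pi.single_apply]
  conv_lhs => rw [hx]
  exact (norm_sum_le _ _).trans (le_of_eq (by simp))

theorem locallyIntegrableOn_coord {Ω : Set (E d)} {G : E d → E d} (hG : LocallyIntegrableOn G Ω)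
    (i : Fin d) : LocallyIntegrableOn (fun x => G x i) Ω := by
  intro x hx
  obtain ⟨s, hs, h⟩ := hG x hx
  exact ⟨s, hs, (EuclideanSpace.proj (𝕜 := ℝ) i).integrable_comp h⟩

theorem HasWeakGradient.ae_eq {Ω : Set (E d)} (hΩ : IsOpen Ω) {u : E d → ℝ} {G G' : E d → E d}
    (h : HasWeakGradient Ω u G) (h' : HasWeakGradient Ω u G') : G =ᵐ[vol Ω] G' := by
  have : ∀ᵐ x ∂(vol Ω), ∀ i, G x i = G' x i := by
    rw [ae_all_iff]; intro i
    refine ae_eq_of_integral_test_eq hΩ (locallyIntegrableOn_coord h.locInt_grad i)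
      (locallyIntegrableOn_coord h'.locInt_grad i) fun φ hφ => ?_
    rw [← neg_inj, ← h.integral_eq i φ hφ, h'.integral_eq i φ hφ]
  exact this.mono fun x hx => by ext i; exact hx i

/-- The weak first and second derivatives of `u` on the unit ball are `G` and `H`, and `u`, `G`
and `H` are in `L^p`. -/
structure SobolevData (p : ℝ) (u : E d → ℝ) (G : E d → E d) (H : E d → Sym d) : Prop where
  memLp : MemLp u (ENNReal.ofReal p) (vol (unitBall d))
  grad : HasWeakGradient (unitBall d) u G
  memLp_grad : MemLp G (ENNReal.ofReal p) (vol (unitBall d))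
  hess : HasWeakHessian (unitBall d) u H
  memLp_hess : ∀ i j, MemLp (fun x => (H x).1 i j) (ENNReal.ofReal p) (vol (unitBall d))

theorem MemW2p.exists_sobolevData {u : E d → ℝ} (hu : MemW2p (unitBall d) p u) :
    ∃ G, SobolevData p u G (weakHessian (unitBall d) u) := by
  obtain ⟨G, hG, hGp⟩ := hu.grad
  obtain ⟨H, hH, hHp⟩ := hu.hess
  have hex : ∃ H, HasWeakHessian (unitBall d) u H := ⟨H, hH⟩
  have hw : HasWeakHessian (unitBall d) u (weakHessian (unitBall d) u) := by
    rw [weakHessian, dif_pos hex]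
    exact hex.choose_spec
  refine ⟨G, hu.memLp, hG, hGp, hw, fun i j => (hHp i j).ae_eq ?_⟩
  filter_upwards [hH.ae_eq (isOpen_unitBall d) hw] with x hx
  rw [hx]

theorem SobolevData.memW2p {u : E d → ℝ} {G : E d → E d} {H : E d → Sym d}
    (h : SobolevData p u G H) : MemW2p (unitBall d) p u :=
  ⟨h.memLp, ⟨G, h.grad, h.memLp_grad⟩, ⟨H, h.hess, h.memLp_hess⟩⟩

theorem SobolevData.weakHessian_ae_eq {u : E d → ℝ} {G : E d → E d} {H : E d → Sym d}
    (h : SobolevData p u G H) : weakHessian (unitBall d) u =ᵐ[vol (unitBall d)] H := by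
  obtain ⟨G', h'⟩ := h.memW2p.exists_sobolevData
  exact h'.hess.ae_eq (isOpen_unitBall d) h.hess

theorem HasWeakGradient.linComb {Ω : Set (E d)} {u v : E d → ℝ} {G G' : E d → E d}
    (h : HasWeakGradient Ω u G) (h' : HasWeakGradient Ω v G') (a b : ℝ) :
    HasWeakGradient Ω (fun x => a * u x + b * v x) (fun x => a • G x + b • G' x) := by
  refine ⟨(h.locInt.smul a).add (h'.locInt.smul b),
    (h.locInt_grad.smul a).add (h'.locInt_grad.smul b), fun i φ hφ => ?_⟩
  have e1 : ∀ x, (a * u x + b * v x) * partialD i φ x =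
      a * (u x * partialD i φ x) + b * (v x * partialD i φ x) := fun x => by ring
  have e2 : ∀ x, (a • G x + b • G' x) i * φ x = a * (G x i * φ x) + b * (G' x i * φ x) := fun x => by
    simp only [PiLp.add_apply, PiLp.smul_apply, smul_eq_mul]; ring
  have i1 := (hφ.partialDeriv i).integrable_mul h.locInt
  have i2 := (hφ.partialDeriv i).integrable_mul h'.locInt
  have i3 := hφ.integrable_mul (locallyIntegrableOn_coord h.locInt_grad i)
  have i4 := hφ.integrable_mul (locallyIntegrableOn_coord h'.locInt_grad i)
  simp only [e1, e2]
  rw [integral_add (i1.const_mul a) (i2.const_mul b), integral_add (i3.const_mul a) (i4.const_mul b)]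
  simp only [integral_const_mul]
  rw [h.integral_eq i φ hφ, h'.integral_eq i φ hφ]
  ring

theorem HasWeakHessian.linComb {Ω : Set (E d)} {u v : E d → ℝ} {H H' : E d → Sym d}
    (h : HasWeakHessian Ω u H) (h' : HasWeakHessian Ω v H') (a b : ℝ) :
    HasWeakHessian Ω (fun x => a * u x + b * v x) (fun x => a • H x + b • H' x) := by
  refine ⟨(h.locInt.smul a).add (h'.locInt.smul b),
    fun i j => ((h.locInt_hess i j).smul a).add ((h'.locInt_hess i j).smul b), fun i j φ hφ => ?_⟩
  have e1 : ∀ x, (a * u x + b * v x) * partialD j (partialD i φ) x =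
      a * (u x * partialD j (partialD i φ) x) + b * (v x * partialD j (partialD i φ) x) :=
    fun x => by ring
  have e2 : ∀ x, (a • H x + b • H' x).1 i j * φ x =
      a * ((H x).1 i j * φ x) + b * ((H' x).1 i j * φ x) := fun x => by
    simp only [Submodule.coe_add, Submodule.coe_smul, Matrix.add_apply, Matrix.smul_apply,
      smul_eq_mul]
    ring
  have i1 := ((hφ.partialDeriv i).partialDeriv j).integrable_mul h.locInt
  have i2 := ((hφ.partialDeriv i).partialDeriv j).integrable_mul h'.locInt
  have i3 := hφ.integrable_mul (h.locInt_hess i j)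
  have i4 := hφ.integrable_mul (h'.locInt_hess i j)
  simp only [e1, e2]
  rw [integral_add (i1.const_mul a) (i2.const_mul b), integral_add (i3.const_mul a) (i4.const_mul b)]
  simp only [integral_const_mul]
  rw [h.integral_eq i j φ hφ, h'.integral_eq i j φ hφ]

theorem SobolevData.linComb {u v : E d → ℝ} {G G' : E d → E d} {H H' : E d → Sym d}
    (h : SobolevData p u G H) (h' : SobolevData p v G' H') (a b : ℝ) :
    SobolevData p (fun x => a * u x + b * v x) (fun x => a • G x + b • G' x)
      (fun x => a • H x + b • H' x) :=
  ⟨(h.memLp.const_mul a).add (h'.memLp.const_mul b), h.grad.linComb h'.grad a b,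
    (h.memLp_grad.const_smul a).add (h'.memLp_grad.const_smul b), h.hess.linComb h'.hess a b,
    fun i j => ((h.memLp_hess i j).const_mul a).add ((h'.memLp_hess i j).const_mul b)⟩

theorem locallyIntegrableOn_of_memLp {ε : Type*} [NormedAddCommGroup ε] (hp : 1 < p)
    {f : E d → ε} (hf : MemLp f (ENNReal.ofReal p) (vol (unitBall d))) :
    LocallyIntegrableOn f (unitBall d) :=
  IntegrableOn.locallyIntegrableOn (hf.integrable (one_le_ofReal hp))

theorem memLp_coord {q : ℝ≥0∞} {μ : Measure (E d)} {G : E d → E d} (hG : MemLp G q μ) (i : Fin d) :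
    MemLp (fun x => G x i) q μ :=
  (EuclideanSpace.proj (𝕜 := ℝ) i).comp_memLp' hG

theorem tendsto_eLpNorm_coord {q : ℝ≥0∞} {μ : Measure (E d)} {G : ℕ → E d → E d} {G' : E d → E d}
    (h : Tendsto (fun n => eLpNorm (fun x => G n x - G' x) q μ) atTop (𝓝 0)) (i : Fin d) :
    Tendsto (fun n => eLpNorm (fun x => G n x i - G' x i) q μ) atTop (𝓝 0) :=
  tendsto_of_tendsto_of_tendsto_of_le_of_le tendsto_const_nhds h (fun _ => zero_le)
    fun n => eLpNorm_mono fun x => norm_coord_le (G n x - G' x) i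

/-- Weak derivatives are closed under `L^p` convergence. -/
theorem SobolevData.of_tendsto (hp : 1 < p) {u : ℕ → E d → ℝ} {G : ℕ → E d → E d}
    {H : ℕ → E d → Sym d} (h : ∀ n, SobolevData p (u n) (G n) (H n)) {u' : E d → ℝ}
    {G' : E d → E d} {H' : E d → Sym d}
    (hu' : MemLp u' (ENNReal.ofReal p) (vol (unitBall d)))
    (hG' : MemLp G' (ENNReal.ofReal p) (vol (unitBall d)))
    (hH' : ∀ i j, MemLp (fun x => (H' x).1 i j) (ENNReal.ofReal p) (vol (unitBall d)))
    (hu : Tendsto (fun n => eLpNorm (fun x => u n x - u' x) (ENNReal.ofReal p)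
      (vol (unitBall d))) atTop (𝓝 0))
    (hG : Tendsto (fun n => eLpNorm (fun x => G n x - G' x) (ENNReal.ofReal p)
      (vol (unitBall d))) atTop (𝓝 0))
    (hH : ∀ i j, Tendsto (fun n => eLpNorm (fun x => (H n x).1 i j - (H' x).1 i j)
      (ENNReal.ofReal p) (vol (unitBall d))) atTop (𝓝 0)) :
    SobolevData p u' G' H' := by
  have hlim : ∀ {f : ℕ → E d → ℝ} {f' φ : E d → ℝ},
      (∀ n, MemLp (f n) (ENNReal.ofReal p) (vol (unitBall d))) →
      MemLp f' (ENNReal.ofReal p) (vol (unitBall d)) →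
      Tendsto (fun n => eLpNorm (fun x => f n x - f' x) (ENNReal.ofReal p)
        (vol (unitBall d))) atTop (𝓝 0) → IsTestFunction (unitBall d) φ →
      Tendsto (fun n => ∫ x in unitBall d, f n x * φ x) atTop
        (𝓝 (∫ x in unitBall d, f' x * φ x)) := by
    intro f f' φ h1 h2 h3 hφ
    obtain ⟨M, hM⟩ := hφ.exists_bound
    exact tendsto_integral_mul_of_tendsto_eLpNorm (μ := vol (unitBall d)) (one_le_ofReal hp) h1 h2
      h3 hφ.smooth.continuous.aestronglyMeasurable hM
  refine ⟨hu', ⟨locallyIntegrableOn_of_memLp hp hu', locallyIntegrableOn_of_memLp hp hG', ?_⟩,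
    hG', ⟨locallyIntegrableOn_of_memLp hp hu',
      fun i j => locallyIntegrableOn_of_memLp hp (hH' i j), ?_⟩, hH'⟩
  · intro i φ hφ
    have l1 := hlim (fun n => (h n).memLp) hu' hu (hφ.partialDeriv i)
    have l2 := hlim (fun n => memLp_coord (h n).memLp_grad i) (memLp_coord hG' i)
      (tendsto_eLpNorm_coord hG i) hφ
    refine tendsto_nhds_unique l1 (l2.neg.congr fun n => ?_)
    exact ((h n).grad.integral_eq i φ hφ).symm
  · intro i j φ hφ
    have l1 := hlim (fun n => (h n).memLp) hu' hu ((hφ.partialDeriv i).partialDeriv j)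
    have l2 := hlim (fun n => (h n).memLp_hess i j) (hH' i j) (hH i j) hφ
    refine tendsto_nhds_unique l1 (l2.congr fun n => ?_)
    exact ((h n).hess.integral_eq i j φ hφ).symm

/-! ### The space `W_0^{1,p}` and the second order Poincaré inequality -/

theorem eLpNorm_linComb_le {α ε : Type*} [MeasurableSpace α] [NormedAddCommGroup ε]
    [NormedSpace ℝ ε] {μ : Measure α} {q : ℝ≥0∞} (hq : 1 ≤ q) {f g : α → ε}
    (hf : AEStronglyMeasurable f μ) (hg : AEStronglyMeasurable g μ) (a b : ℝ) :
    eLpNorm (fun x => a • f x + b • g x) q μ ≤ ‖a‖ₑ * eLpNorm f q μ + ‖b‖ₑ * eLpNorm g q μ := by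
  have h := eLpNorm_add_le (hf.const_smul a) (hg.const_smul b) hq
  rwa [eLpNorm_const_smul, eLpNorm_const_smul] at h

theorem tendsto_eLpNorm_linComb {α ε : Type*} [MeasurableSpace α] [NormedAddCommGroup ε]
    [NormedSpace ℝ ε] {μ : Measure α} {q : ℝ≥0∞} (hq : 1 ≤ q) {f g : ℕ → α → ε}
    (hf : ∀ n, AEStronglyMeasurable (f n) μ) (hg : ∀ n, AEStronglyMeasurable (g n) μ) (a b : ℝ)
    (hf0 : Tendsto (fun n => eLpNorm (f n) q μ) atTop (𝓝 0))
    (hg0 : Tendsto (fun n => eLpNorm (g n) q μ) atTop (𝓝 0)) :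
    Tendsto (fun n => eLpNorm (fun x => a • f n x + b • g n x) q μ) atTop (𝓝 0) := by
  have h1 := (ENNReal.Tendsto.const_mul hf0 (Or.inr (enorm_ne_top (x := a)))).add
    (ENNReal.Tendsto.const_mul hg0 (Or.inr (enorm_ne_top (x := b))))
  simp only [mul_zero, add_zero] at h1
  exact tendsto_of_tendsto_of_tendsto_of_le_of_le tendsto_const_nhds h1 (fun _ => zero_le)
    fun n => eLpNorm_linComb_le hq (hf n) (hg n) a b

theorem continuous_gradient {φ : E d → ℝ} (hφ : ContDiff ℝ ∞ φ) : Continuous (gradient φ) :=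
  (LinearIsometryEquiv.continuous _).comp (hφ.continuous_fderiv (by simp))

/-- The approximating test functions converge to any given version of the weak gradient. -/
theorem MemW01p.exists_approx {v : E d → ℝ} {G : E d → E d} (hv : MemW01p (unitBall d) p v)
    (hG : HasWeakGradient (unitBall d) v G) :
    ∃ φ : ℕ → E d → ℝ, (∀ n, IsTestFunction (unitBall d) (φ n)) ∧
      Tendsto (fun n => eLpNorm (fun x => v x - φ n x) (ENNReal.ofReal p) (vol (unitBall d)))
        atTop (𝓝 0) ∧
      Tendsto (fun n => eLpNorm (fun x => G x - gradient (φ n) x) (ENNReal.ofReal p)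
        (vol (unitBall d))) atTop (𝓝 0) := by
  obtain ⟨G', -, hG', -, φ, h1, h2, h3⟩ := hv
  refine ⟨φ, h1, h2, h3.congr fun n => eLpNorm_congr_ae ?_⟩
  filter_upwards [hG'.ae_eq (isOpen_unitBall d) hG] with x hx
  rw [hx]

theorem MemW01p.linComb (hp : 1 < p) {v w : E d → ℝ} (hv : MemW01p (unitBall d) p v)
    (hw : MemW01p (unitBall d) p w) (a b : ℝ) :
    MemW01p (unitBall d) p fun x => a * v x + b * w x := by
  obtain ⟨G, h1, h2, h3, φ, h4, h5, h6⟩ := hv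
  obtain ⟨G', h1', h2', h3', φ', h4', h5', h6'⟩ := hw
  refine ⟨fun x => a • G x + b • G' x, (h1.const_mul a).add (h1'.const_mul b), h2.linComb h2' a b,
    (h3.const_smul a).add (h3'.const_smul b), fun n x => a * φ n x + b * φ' n x,
    fun n => (h4 n).linComb (h4' n) a b, ?_, ?_⟩
  · refine (tendsto_eLpNorm_linComb (one_le_ofReal hp)
      (fun n => h1.1.sub (h4 n).smooth.continuous.aestronglyMeasurable)
      (fun n => h1'.1.sub (h4' n).smooth.continuous.aestronglyMeasurable) a b h5 h5').congr
      fun n => ?_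
    congr 1 with x
    simp only [Pi.sub_apply, smul_eq_mul]; ring
  · refine (tendsto_eLpNorm_linComb (one_le_ofReal hp)
      (fun n => h3.1.sub (continuous_gradient (h4 n).smooth).aestronglyMeasurable)
      (fun n => h3'.1.sub (continuous_gradient (h4' n).smooth).aestronglyMeasurable) a b
      h6 h6').congr fun n => ?_
    congr 1 with x : 1
    rw [gradient_linComb (h4 n).smooth (h4' n).smooth]
    simp only [Pi.sub_apply, smul_sub]; abel

/-- `W_0^{1,p}` is closed in `W^{1,p}`. -/
theorem MemW01p.of_tendsto (hp : 1 < p) {v : ℕ → E d → ℝ} {G : ℕ → E d → E d}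
    (h : ∀ n, MemW01p (unitBall d) p (v n)) (hG : ∀ n, HasWeakGradient (unitBall d) (v n) (G n))
    (hvp : ∀ n, MemLp (v n) (ENNReal.ofReal p) (vol (unitBall d)))
    (hGp : ∀ n, MemLp (G n) (ENNReal.ofReal p) (vol (unitBall d)))
    {v' : E d → ℝ} {G' : E d → E d} (hG' : HasWeakGradient (unitBall d) v' G')
    (hvp' : MemLp v' (ENNReal.ofReal p) (vol (unitBall d)))
    (hGp' : MemLp G' (ENNReal.ofReal p) (vol (unitBall d)))
    (hv0 : Tendsto (fun n => eLpNorm (fun x => v n x - v' x) (ENNReal.ofReal p)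
      (vol (unitBall d))) atTop (𝓝 0))
    (hG0 : Tendsto (fun n => eLpNorm (fun x => G n x - G' x) (ENNReal.ofReal p)
      (vol (unitBall d))) atTop (𝓝 0)) :
    MemW01p (unitBall d) p v' := by
  have hex : ∀ n : ℕ, ∃ φ : E d → ℝ, IsTestFunction (unitBall d) φ ∧
      eLpNorm (fun x => v n x - φ x) (ENNReal.ofReal p) (vol (unitBall d)) ≤
        ((n : ℝ≥0∞) + 1)⁻¹ ∧
      eLpNorm (fun x => G n x - gradient φ x) (ENNReal.ofReal p) (vol (unitBall d)) ≤
        ((n : ℝ≥0∞) + 1)⁻¹ := by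
    intro n
    obtain ⟨φ, h1, h2, h3⟩ := (h n).exists_approx (hG n)
    have hpos : (0 : ℝ≥0∞) < ((n : ℝ≥0∞) + 1)⁻¹ := by
      rw [ENNReal.inv_pos]
      exact ENNReal.add_ne_top.2 ⟨ENNReal.natCast_ne_top n, ENNReal.one_ne_top⟩
    obtain ⟨k, hk1, hk2⟩ := ((h2.eventually (ge_mem_nhds hpos)).and
      (h3.eventually (ge_mem_nhds hpos))).exists
    exact ⟨φ k, h1 k, hk1, hk2⟩
  choose φ h1 h2 h3 using hex
  have hinv : Tendsto (fun n : ℕ => ((n : ℝ≥0∞) + 1)⁻¹) atTop (𝓝 0) := by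
    have := (tendsto_add_atTop_iff_nat 1).2 ENNReal.tendsto_inv_nat_nhds_zero
    simpa using this
  have t1 := tendsto_of_tendsto_of_tendsto_of_le_of_le tendsto_const_nhds hinv
    (fun _ => zero_le) h2
  have t2 := tendsto_of_tendsto_of_tendsto_of_le_of_le tendsto_const_nhds hinv
    (fun _ => zero_le) h3
  refine ⟨G', hvp', hG', hGp', φ, h1, ?_, ?_⟩
  · refine (tendsto_eLpNorm_linComb (one_le_ofReal hp)
      (fun n => (hvp n).1.sub (h1 n).smooth.continuous.aestronglyMeasurable)
      (fun n => (hvp n).1.sub hvp'.1) 1 (-1) t1 hv0).congr fun n => ?_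
    congr 1 with x
    simp only [Pi.sub_apply, smul_eq_mul]; ring
  · refine (tendsto_eLpNorm_linComb (one_le_ofReal hp)
      (fun n => (hGp n).1.sub (continuous_gradient (h1 n).smooth).aestronglyMeasurable)
      (fun n => (hGp n).1.sub hGp'.1) 1 (-1) t2 hG0).congr fun n => ?_
    congr 1 with x : 1
    simp only [Pi.sub_apply, one_smul, neg_smul]; abel

theorem IsTestFunction.eLpNorm_le (hd : 0 < d) (hp : 1 < p) {φ : E d → ℝ}
    (hφ : IsTestFunction (unitBall d) φ) :
    eLpNorm φ (ENNReal.ofReal p) (vol (unitBall d)) ≤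
      2 * eLpNorm (gradient φ) (ENNReal.ofReal p) (vol (unitBall d)) := by
  have hp0 : 0 < p := by linarith
  have h := hφ.lintegral_rpow_le hd hp
  have h1 : ∫⁻ x in unitBall d, ‖φ x‖ₑ ^ p ≤ ∫⁻ x, ‖φ x‖ₑ ^ p := setLIntegral_le_lintegral _ _
  have h2 : ∫⁻ x, ‖fderiv ℝ φ x‖ₑ ^ p = ∫⁻ x in unitBall d, ‖gradient φ x‖ₑ ^ p := by
    simp only [enorm_gradient]
    rw [← lintegral_indicator (measurableSet_unitBall d)]
    refine lintegral_congr fun x => ?_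
    by_cases hx : x ∈ unitBall d
    · rw [Set.indicator_of_mem hx]
    · have : fderiv ℝ φ x = 0 := image_eq_zero_of_notMem_tsupport fun h =>
        hx (hφ.support_subset (tsupport_fderiv_subset ℝ h))
      have h0 : ‖fderiv ℝ φ x‖ₑ = 0 := by
        rw [← ofReal_norm, this, norm_zero, ENNReal.ofReal_zero]
      rw [Set.indicator_of_notMem hx, h0, ENNReal.zero_rpow_of_pos hp0]
  rw [h2] at h
  rw [eLpNorm_ofReal_eq hp, eLpNorm_ofReal_eq hp]
  refine (ENNReal.rpow_le_rpow (h1.trans h) (by positivity)).trans (le_of_eq ?_)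
  rw [ENNReal.mul_rpow_of_nonneg _ _ (by positivity), ← ENNReal.rpow_mul, mul_one_div_cancel hp0.ne',
    ENNReal.rpow_one]
  rfl

/-- The Friedrichs inequality in `W_0^{1,p}`. -/
theorem MemW01p.eLpNorm_le (hd : 0 < d) (hp : 1 < p) {v : E d → ℝ} {G : E d → E d}
    (hv : MemW01p (unitBall d) p v) (hG : HasWeakGradient (unitBall d) v G)
    (hvp : MemLp v (ENNReal.ofReal p) (vol (unitBall d)))
    (hGp : MemLp G (ENNReal.ofReal p) (vol (unitBall d))) :
    eLpNorm v (ENNReal.ofReal p) (vol (unitBall d)) ≤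
      2 * eLpNorm G (ENNReal.ofReal p) (vol (unitBall d)) := by
  obtain ⟨φ, h1, h2, h3⟩ := hv.exists_approx hG
  set q := ENNReal.ofReal p
  set μ := vol (unitBall d)
  have hq : 1 ≤ q := one_le_ofReal hp
  have hlim : Tendsto (fun n => eLpNorm (fun x => v x - φ n x) q μ +
      2 * (eLpNorm G q μ + eLpNorm (fun x => G x - gradient (φ n) x) q μ)) atTop
      (𝓝 (0 + 2 * (eLpNorm G q μ + 0))) :=
    h2.add (ENNReal.Tendsto.const_mul (tendsto_const_nhds.add h3) (Or.inr (by simp)))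
  rw [zero_add, add_zero] at hlim
  refine ge_of_tendsto' hlim fun n => ?_
  have hφm : AEStronglyMeasurable (φ n) μ := (h1 n).smooth.continuous.aestronglyMeasurable
  have hgm : AEStronglyMeasurable (gradient (φ n)) μ :=
    (continuous_gradient (h1 n).smooth).aestronglyMeasurable
  have e1 : eLpNorm v q μ ≤ eLpNorm (fun x => v x - φ n x) q μ + eLpNorm (φ n) q μ := by
    have := eLpNorm_add_le (hvp.1.sub hφm) hφm hq
    rwa [sub_add_cancel] at this
  have e2 : eLpNorm (gradient (φ n)) q μ ≤
      eLpNorm G q μ + eLpNorm (fun x => G x - gradient (φ n) x) q μ := by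
    have := eLpNorm_sub_le hGp.1 (hGp.1.sub hgm) hq
    rwa [sub_sub_cancel] at this
  exact e1.trans (add_le_add_right (((h1 n).eLpNorm_le hd hp).trans (mul_le_mul_right e2 _)) _)

theorem IsTestFunction.integral_partialD {φ : E d → ℝ} (hφ : IsTestFunction (unitBall d) φ)
    (i : Fin d) : ∫ x in unitBall d, partialD i φ x = 0 := by
  have h1 : ∫ x in unitBall d, partialD i φ x = ∫ x, partialD i φ x :=
    setIntegral_eq_integral_of_forall_compl_eq_zero fun x hx => (hφ.partialDeriv i).eq_zero hx
  have hi : Integrable (partialD i φ) :=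
    (hφ.partialDeriv i).smooth.continuous.integrable_of_hasCompactSupport
      (hφ.partialDeriv i).compact_support
  have hφi : Integrable φ := hφ.smooth.continuous.integrable_of_hasCompactSupport
    hφ.compact_support
  have h2 := integral_mul_fderiv_eq_neg_fderiv_mul_of_integrable (μ := (volume : Measure (E d)))
    (f := fun _ => (1 : ℝ)) (g := φ) (v := EuclideanSpace.single i 1) (by simp)
    (by simp only [one_mul]; exact hi) (by simpa using hφi) (fun x _ => differentiableAt_const _)
    (fun x _ => hφ.smooth.differentiable (by simp) x)
  rw [h1]
  simpa [partialD] using h2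

/-- The weak gradient of a function in `W_0^{1,p}` has mean zero. -/
theorem MemW01p.integral_grad (hp : 1 < p) {v : E d → ℝ} {G : E d → E d}
    (hv : MemW01p (unitBall d) p v) (hG : HasWeakGradient (unitBall d) v G)
    (hGp : MemLp G (ENNReal.ofReal p) (vol (unitBall d))) (i : Fin d) :
    ∫ x in unitBall d, G x i = 0 := by
  obtain ⟨φ, h1, -, h3⟩ := hv.exists_approx hG
  have hq := one_le_ofReal hp
  have h4 : Tendsto (fun n => eLpNorm (fun x => (G x i - partialD i (φ n) x) - 0)
      (ENNReal.ofReal p) (vol (unitBall d))) atTop (𝓝 0) := by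
    refine tendsto_of_tendsto_of_tendsto_of_le_of_le tendsto_const_nhds h3 (fun _ => zero_le)
      fun n => eLpNorm_mono fun x => ?_
    rw [sub_zero, ← gradient_apply]
    exact norm_coord_le (G x - gradient (φ n) x) i
  have hDp : ∀ n, MemLp (partialD i (φ n)) (ENNReal.ofReal p) (vol (unitBall d)) := by
    intro n
    obtain ⟨M, hM⟩ := ((h1 n).partialDeriv i).exists_bound
    exact MemLp.of_bound ((h1 n).partialDeriv i).smooth.continuous.aestronglyMeasurable M
      (ae_of_all _ hM)
  have h5 := tendsto_integral_mul_of_tendsto_eLpNorm hq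
    (fun n => (memLp_coord hGp i).sub (hDp n)) (MemLp.zero' (ε := ℝ)) h4
    (aestronglyMeasurable_const (b := (1 : ℝ))) (M := 1) (fun _ => by simp)
  have h6 : ∀ n, ∫ x, (fun x => G x i - partialD i (φ n) x) x * 1 ∂(vol (unitBall d)) =
      ∫ x in unitBall d, G x i := by
    intro n
    simp only [mul_one]
    rw [integral_sub ((memLp_coord hGp i).integrable hq) ((hDp n).integrable hq)]
    have := (h1 n).integral_partialD i
    rw [show ∫ x, partialD i (φ n) x ∂(vol (unitBall d)) = 0 from this, sub_zero]
    rfl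
  have h7 : Tendsto (fun _ : ℕ => ∫ x in unitBall d, G x i) atTop (𝓝 0) := by
    have := h5.congr h6
    simpa using this
  exact tendsto_nhds_unique tendsto_const_nhds h7

/-- A function `w` of mean zero satisfies `μ(univ) w(x) = ∫ (w(x) - w(y)) dμ(y)`, so that the double
integral of differences controls its `L^p` norm. -/
theorem lintegral_rpow_mul_le_of_integral_eq_zero {α : Type*} [MeasurableSpace α] {μ : Measure α}
    [IsFiniteMeasure μ] (hp : 1 < p) {w : α → ℝ} (hw : Integrable w μ) (h0 : ∫ x, w x ∂μ = 0) :
    (∫⁻ x, ‖w x‖ₑ ^ p ∂μ) * μ Set.univ ^ p ≤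
      μ Set.univ ^ (p - 1) * ∫⁻ x, ∫⁻ y, ‖w x - w y‖ₑ ^ p ∂μ ∂μ := by
  have hp0 : 0 < p := by linarith
  have hpt : ∀ x, ‖w x‖ₑ ^ p * μ Set.univ ^ p ≤
      μ Set.univ ^ (p - 1) * ∫⁻ y, ‖w x - w y‖ₑ ^ p ∂μ := by
    intro x
    have h1 : ∫ y, (w x - w y) ∂μ = μ.real Set.univ * w x := by
      rw [integral_sub (integrable_const _) hw, h0, sub_zero, integral_const, smul_eq_mul]
    have h2 : ‖w x‖ₑ * μ Set.univ ≤ ∫⁻ y, ‖w x - w y‖ₑ ∂μ := by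
      refine le_trans (le_of_eq ?_) (enorm_integral_le_lintegral_enorm _)
      rw [h1, enorm_mul, mul_comm, Real.enorm_of_nonneg measureReal_nonneg, ofReal_measureReal]
    rw [← ENNReal.mul_rpow_of_nonneg _ _ hp0.le]
    refine (ENNReal.rpow_le_rpow h2 hp0.le).trans (rpow_lintegral_le hp ?_)
    exact (hw.aemeasurable.const_sub (w x)).enorm
  rw [← lintegral_mul_const' _ _ (ENNReal.rpow_ne_top_of_nonneg hp0.le (measure_ne_top _ _)),
    ← lintegral_const_mul' _ _
      (ENNReal.rpow_ne_top_of_nonneg (by linarith) (measure_ne_top _ _))]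
  exact lintegral_mono hpt

/-- The sum of the `L^p` seminorms of the entries of a matrix valued function. -/
noncomputable def hessNorm (p : ℝ) (H : E d → Sym d) : ℝ≥0∞ :=
  ∑ i, ∑ j, eLpNorm (fun x => (H x).1 i j) (ENNReal.ofReal p) (vol (unitBall d))

theorem eLpNorm_le_hessNorm (H : E d → Sym d) (i j : Fin d) :
    eLpNorm (fun x => (H x).1 i j) (ENNReal.ofReal p) (vol (unitBall d)) ≤ hessNorm p H :=
  (Finset.single_le_sum (f := fun j => eLpNorm (fun x => (H x).1 i j) (ENNReal.ofReal p)
      (vol (unitBall d))) (fun _ _ => zero_le) (Finset.mem_univ j)).trans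
    (Finset.single_le_sum (f := fun i => ∑ j, eLpNorm (fun x => (H x).1 i j) (ENNReal.ofReal p)
      (vol (unitBall d))) (fun _ _ => zero_le) (Finset.mem_univ i))

theorem eLpNorm_le_sum_coord (hp : 1 < p) {μ : Measure (E d)} {G : E d → E d}
    (hG : MemLp G (ENNReal.ofReal p) μ) :
    eLpNorm G (ENNReal.ofReal p) μ ≤ ∑ i, eLpNorm (fun x => G x i) (ENNReal.ofReal p) μ := by
  have h1 : eLpNorm G (ENNReal.ofReal p) μ ≤
      eLpNorm (∑ i, fun x => ‖G x i‖) (ENNReal.ofReal p) μ := by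
    refine eLpNorm_mono_real fun x => ?_
    rw [Finset.sum_apply]
    exact norm_le_sum_norm_coord (G x)
  refine h1.trans ((eLpNorm_sum_le (fun i _ => (memLp_coord hG i).1.norm)
    (one_le_ofReal hp)).trans (le_of_eq ?_))
  simp only [eLpNorm_norm]

/-- The second order Poincaré inequality in `W^{2,p} ∩ W_0^{1,p}`: the Hessian alone controls
the function and its gradient. The gradient has mean zero, so the Poincaré–Wirtinger inequality
applies to each of its components, and the function is controlled by the Friedrichs inequality. -/
theorem exists_eLpNorm_le_hessNorm (hd : 0 < d) (hp : 1 < p) :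
    ∃ C : ℝ≥0∞, C ≠ ⊤ ∧ ∀ (v : E d → ℝ) (G : E d → E d) (H : E d → Sym d),
      SobolevData p v G H → MemW01p (unitBall d) p v →
      eLpNorm v (ENNReal.ofReal p) (vol (unitBall d)) ≤ C * hessNorm p H ∧
      eLpNorm G (ENNReal.ofReal p) (vol (unitBall d)) ≤ C * hessNorm p H := by
  have hp0 : 0 < p := by linarith
  set V := vol (unitBall d) Set.univ with hV
  have hVt : V ≠ ⊤ := measure_ne_top _ _
  have hV0 : V ≠ 0 := by
    rw [hV, vol, Measure.restrict_apply_univ]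
    exact (isOpen_unitBall d).measure_ne_zero volume ⟨0, by simp [unitBall]⟩
  set K : ℝ≥0∞ := V ^ (p - 1) * (2 ^ p * (2 ^ d * V) * (d ^ (p - 1) * d)) with hK
  have hKt : K ≠ ⊤ := by
    have h1 : V ^ (p - 1) ≠ ⊤ := ENNReal.rpow_ne_top_of_nonneg (by linarith) hVt
    have h2 : (2 : ℝ≥0∞) ^ p ≠ ⊤ := ENNReal.rpow_ne_top_of_nonneg hp0.le (by simp)
    have h3 : (d : ℝ≥0∞) ^ (p - 1) ≠ ⊤ :=
      ENNReal.rpow_ne_top_of_nonneg (by linarith) (ENNReal.natCast_ne_top d)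
    exact ENNReal.mul_ne_top h1 (ENNReal.mul_ne_top (ENNReal.mul_ne_top h2
      (ENNReal.mul_ne_top (by simp) hVt)) (ENNReal.mul_ne_top h3 (ENNReal.natCast_ne_top d)))
  set C₀ : ℝ≥0∞ := K ^ (1 / p) / V with hC₀
  have hC₀t : C₀ ≠ ⊤ :=
    ENNReal.div_ne_top (ENNReal.rpow_ne_top_of_nonneg (by positivity) hKt) hV0
  have hcoord : ∀ (v : E d → ℝ) (G : E d → E d) (H : E d → Sym d),
      SobolevData p v G H → MemW01p (unitBall d) p v → ∀ i,
      eLpNorm (fun x => G x i) (ENNReal.ofReal p) (vol (unitBall d)) ≤ C₀ * hessNorm p H := by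
    intro v G H h hv i
    have hGi : IntegrableOn (fun x => G x i) (unitBall d) :=
      (memLp_coord h.memLp_grad i).integrable (one_le_ofReal hp)
    -- Testing the definition of the gradient with `∂ⱼψ` shows that `∂ⱼ Gᵢ = Hⱼᵢ` weakly.
    have hweak : ∀ j ψ, IsTestFunction (unitBall d) ψ →
        ∫ x in unitBall d, G x i * partialD j ψ x = - ∫ x in unitBall d, (H x).1 j i * ψ x := by
      intro j ψ hψ
      rw [← h.hess.integral_eq j i ψ hψ, h.grad.integral_eq i _ (hψ.partialDeriv j), neg_neg]
    have hPW := lintegral_lintegral_enorm_sub_rpow_le_of_weak hp hGi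
      (fun j => (h.memLp_hess j i).integrable (one_le_ofReal hp)) hweak
    have h1 := lintegral_rpow_mul_le_of_integral_eq_zero (μ := vol (unitBall d)) hp hGi
      (hv.integral_grad hp h.grad h.memLp_grad i)
    have hsum : ∑ j, ∫⁻ x in unitBall d, ‖(H x).1 j i‖ₑ ^ p ≤ d * hessNorm p H ^ p := by
      refine (Finset.sum_le_card_nsmul _ _ (hessNorm p H ^ p) fun j _ => ?_).trans (by simp)
      refine le_trans (le_of_eq ?_) (ENNReal.rpow_le_rpow (eLpNorm_le_hessNorm H j i) hp0.le)
      exact (eLpNorm_ofReal_rpow hp _).symm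
    have h2 : (eLpNorm (fun x => G x i) (ENNReal.ofReal p) (vol (unitBall d)) * V) ^ p ≤
        K * hessNorm p H ^ p := by
      rw [ENNReal.mul_rpow_of_nonneg _ _ hp0.le, eLpNorm_ofReal_rpow hp]
      refine h1.trans ?_
      have hVv : volume (unitBall d) = V := by rw [hV, vol, Measure.restrict_apply_univ]
      rw [hVv] at hPW
      calc _ ≤ V ^ (p - 1) * (2 ^ p * (2 ^ d * V) * (d ^ (p - 1) * (d * hessNorm p H ^ p))) :=
            mul_le_mul_right (hPW.trans (mul_le_mul_right (mul_le_mul_right hsum _) _)) _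
        _ = K * hessNorm p H ^ p := by rw [hK]; ring
    have h3 := ENNReal.rpow_le_rpow h2 (by positivity : 0 ≤ 1 / p)
    rw [← ENNReal.rpow_mul, ENNReal.mul_rpow_of_nonneg K _ (by positivity), ← ENNReal.rpow_mul,
      mul_one_div_cancel hp0.ne', ENNReal.rpow_one, ENNReal.rpow_one] at h3
    rw [hC₀, ← ENNReal.mul_div_right_comm]
    exact (ENNReal.le_div_iff_mul_le (Or.inl hV0) (Or.inl hVt)).2 h3
  refine ⟨2 * (d * C₀), ENNReal.mul_ne_top (by simp)
    (ENNReal.mul_ne_top (ENNReal.natCast_ne_top d) hC₀t), fun v G H h hv => ?_⟩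
  have hG : eLpNorm G (ENNReal.ofReal p) (vol (unitBall d)) ≤ d * C₀ * hessNorm p H := by
    refine (eLpNorm_le_sum_coord hp h.memLp_grad).trans ?_
    refine (Finset.sum_le_card_nsmul _ _ _ fun i _ => hcoord v G H h hv i).trans ?_
    simp [mul_assoc]
  constructor
  · refine (hv.eLpNorm_le hd hp h.grad h.memLp h.memLp_grad).trans ?_
    rw [mul_assoc]
    exact mul_le_mul_right hG _
  · refine hG.trans ?_
    rw [mul_assoc 2]
    exact le_mul_of_one_le_left zero_le one_le_two

/-! ### Convex integrands of linear growth -/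

theorem opNorm_add_le (M N : Sym d) : opNorm (M + N) ≤ opNorm M + opNorm N := by
  simp only [opNorm, Submodule.coe_add, map_add]
  exact norm_add_le _ _

theorem opNorm_smul {c : ℝ} (hc : 0 ≤ c) (M : Sym d) : opNorm (c • M) = c * opNorm M := by
  simp only [opNorm, Submodule.coe_smul, map_smul, norm_smul, Real.norm_of_nonneg hc]

theorem opNorm_nonneg (M : Sym d) : 0 ≤ opNorm M := norm_nonneg _

theorem abs_entry_le_opNorm (M : Sym d) (i j : Fin d) : |M.1 i j| ≤ opNorm M := by
  have h1 := (Matrix.toEuclideanCLM (n := Fin d) (𝕜 := ℝ) M.1).le_opNorm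
    (EuclideanSpace.single j 1)
  rw [PiLp.norm_single, norm_one, mul_one] at h1
  have h2 := norm_coord_le (Matrix.toEuclideanCLM (n := Fin d) (𝕜 := ℝ) M.1
    (EuclideanSpace.single j 1)) i
  rw [Matrix.ofLp_toEuclideanCLM] at h2
  simp only [PiLp.ofLp_single, Matrix.mulVec_single_one, Matrix.col_apply, Real.norm_eq_abs] at h2
  exact h2.trans h1

theorem opNorm_le_sum (M : Sym d) : opNorm M ≤ ∑ i, ∑ j, |M.1 i j| := by
  refine ContinuousLinearMap.opNorm_le_bound _ (by positivity) fun x => ?_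
  set y := Matrix.toEuclideanCLM (n := Fin d) (𝕜 := ℝ) M.1 x with hy
  refine (norm_le_sum_norm_coord y).trans ?_
  rw [Finset.sum_mul]
  refine Finset.sum_le_sum fun i _ => ?_
  rw [Finset.sum_mul, hy, Matrix.ofLp_toEuclideanCLM, Matrix.mulVec, dotProduct]
  refine (norm_sum_le _ _).trans (Finset.sum_le_sum fun j _ => ?_)
  rw [norm_mul, Real.norm_eq_abs]
  exact mul_le_mul_of_nonneg_left (norm_coord_le x j) (abs_nonneg _)

/-- The consequences of convexity and linear growth of `F` that are used: besides convexity, `F`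
is nonnegative, controls the entries of its argument with the constant `c`, and is Lipschitz with
respect to them with the constant `L`. -/
structure NormLike (F : Sym d → ℝ) (c L : ℝ) : Prop where
  convex : ConvexOn ℝ Set.univ F
  map_zero : F 0 = 0
  nonneg : ∀ M, 0 ≤ F M
  entry_le : ∀ M i j, |M.1 i j| ≤ c * F M
  lipschitz : ∀ A B : Sym d, |F A - F B| ≤ L * ∑ i, ∑ j, |A.1 i j - B.1 i j|

/-- A convex function which grows at most linearly is Lipschitz: along the ray from `B` through
`A`, convexity bounds the slope between `B` and `A` by the slope at infinity. -/
theorem sub_le_of_convex_of_le_opNorm {F : Sym d → ℝ} (hconv : ConvexOn ℝ Set.univ F) {L : ℝ}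
    (hL : 0 ≤ L) (hF : ∀ M, F M ≤ L * opNorm M) (A B : Sym d) : F A - F B ≤ L * opNorm (A - B) := by
  have hs : ∀ s : ℝ, 1 ≤ s →
      F A ≤ (1 - s⁻¹) * F B + (s⁻¹ * (L * opNorm B) + L * opNorm (A - B)) := by
    intro s hs
    have hs0 : 0 < s := by linarith
    have hinv : s⁻¹ ≤ 1 := inv_le_one_of_one_le₀ hs
    have hinv0 : 0 < s⁻¹ := inv_pos.2 hs0
    have hA : A = (1 - s⁻¹) • B + s⁻¹ • (B + s • (A - B)) := by
      refine Subtype.ext (Matrix.ext fun i j => ?_)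
      simp only [Submodule.coe_add, Submodule.coe_smul, Submodule.coe_sub, Matrix.add_apply,
        Matrix.smul_apply, Matrix.sub_apply, smul_eq_mul]
      field_simp
      ring
    have h1 := hconv.2 (Set.mem_univ B) (Set.mem_univ (B + s • (A - B)))
      (by linarith : 0 ≤ 1 - s⁻¹) hinv0.le (by ring)
    rw [← hA, smul_eq_mul, smul_eq_mul] at h1
    have h2 : F (B + s • (A - B)) ≤ L * (opNorm B + s * opNorm (A - B)) := by
      refine (hF _).trans (mul_le_mul_of_nonneg_left ?_ hL)
      refine (opNorm_add_le _ _).trans ?_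
      rw [opNorm_smul hs0.le]
    have h3 := mul_le_mul_of_nonneg_left h2 hinv0.le
    have h4 : s⁻¹ * (L * (opNorm B + s * opNorm (A - B))) =
        s⁻¹ * (L * opNorm B) + L * opNorm (A - B) := by
      field_simp
    linarith
  have hinv : Tendsto (fun s : ℝ => s⁻¹) atTop (𝓝 0) := tendsto_inv_atTop_zero
  have hlim : Tendsto (fun s : ℝ => (1 - s⁻¹) * F B + (s⁻¹ * (L * opNorm B) + L * opNorm (A - B)))
      atTop (𝓝 ((1 - 0) * F B + (0 * (L * opNorm B) + L * opNorm (A - B)))) :=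
    ((tendsto_const_nhds.sub hinv).mul_const _).add ((hinv.mul_const _).add_const _)
  have := ge_of_tendsto hlim ((eventually_ge_atTop 1).mono hs)
  linarith

theorem NormLike.of_growth {F : Sym d → ℝ} (hconv : ConvexOn ℝ Set.univ F) {lam Lam : ℝ}
    (hlam : 0 < lam) (hle : lam ≤ Lam)
    (hgrowth : ∀ M, lam * opNorm M ≤ F M ∧ F M ≤ Lam * opNorm M) : NormLike F lam⁻¹ Lam := by
  have hL : 0 ≤ Lam := by linarith
  have h0 : opNorm (0 : Sym d) = 0 := by simp [opNorm]
  refine ⟨hconv, ?_, fun M => ?_, fun M i j => ?_, fun A B => ?_⟩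
  · have := hgrowth 0
    rw [h0] at this
    linarith [this.1, this.2]
  · exact (mul_nonneg hlam.le (opNorm_nonneg M)).trans (hgrowth M).1
  · refine (abs_entry_le_opNorm M i j).trans ?_
    rw [inv_mul_eq_div, le_div_iff₀ hlam, mul_comm]
    exact (hgrowth M).1
  · have h1 := sub_le_of_convex_of_le_opNorm hconv hL (fun M => (hgrowth M).2) A B
    have h2 := sub_le_of_convex_of_le_opNorm hconv hL (fun M => (hgrowth M).2) B A
    have e1 := mul_le_mul_of_nonneg_left (opNorm_le_sum (A - B)) hL
    have e2 := mul_le_mul_of_nonneg_left (opNorm_le_sum (B - A)) hL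
    simp only [Submodule.coe_sub, Matrix.sub_apply] at e1 e2
    simp only [fun i j => abs_sub_comm (B.1 i j) (A.1 i j)] at e2
    rw [abs_le]
    constructor <;> linarith

/-- The symmetric part of a square array of numbers. -/
noncomputable def symPart (A : Fin d → Fin d → ℝ) : Sym d :=
  ⟨Matrix.of fun i j => (A i j + A j i) / 2, by
    ext i j
    simp [add_comm]⟩

theorem symPart_entries (M : Sym d) : symPart (fun i j => M.1 i j) = M := by
  refine Subtype.ext (Matrix.ext fun i j => ?_)
  have h : M.1 j i = M.1 i j := M.2.apply i j
  simp [symPart, h]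

variable {F : Sym d → ℝ} {c L : ℝ}

/-- Only the entries of `H` are known to be measurable, so `F` is composed with the continuous
extension `symPart` to all square arrays. -/
theorem NormLike.aestronglyMeasurable_comp (hF : NormLike F c L) {μ : Measure (E d)}
    {H : E d → Sym d} (hH : ∀ i j, AEStronglyMeasurable (fun x => (H x).1 i j) μ) :
    AEStronglyMeasurable (fun x => F (H x)) μ := by
  have hcont : Continuous fun A : Fin d → Fin d → ℝ => F (symPart A) := by
    rw [continuous_iff_continuousAt]
    intro B
    have h1 : Continuous fun A : Fin d → Fin d → ℝ =>
        L * ∑ i, ∑ j, |(symPart A).1 i j - (symPart B).1 i j| := by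
      simp only [symPart, Matrix.of_apply]
      fun_prop
    have h2 := h1.tendsto B
    simp only [sub_self, abs_zero, Finset.sum_const_zero, mul_zero] at h2
    rw [ContinuousAt, tendsto_iff_dist_tendsto_zero]
    exact squeeze_zero (fun _ => dist_nonneg) (fun A => hF.lipschitz _ _) h2
  have hm : AEMeasurable (fun x (i j : Fin d) => (H x).1 i j) μ :=
    aemeasurable_pi_lambda _ fun i => aemeasurable_pi_lambda _ fun j => (hH i j).aemeasurable
  have := (hcont.measurable.comp_aemeasurable hm).aestronglyMeasurable
  simpa only [Function.comp_def, symPart_entries] using this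

theorem eLpNorm_sub_le_hessNorm (hF : NormLike F c L) (hp : 1 < p) {H H' : E d → Sym d}
    (hH : ∀ i j, MemLp (fun x => (H x).1 i j) (ENNReal.ofReal p) (vol (unitBall d)))
    (hH' : ∀ i j, MemLp (fun x => (H' x).1 i j) (ENNReal.ofReal p) (vol (unitBall d))) :
    eLpNorm (fun x => F (H x) - F (H' x)) (ENNReal.ofReal p) (vol (unitBall d)) ≤
      ENNReal.ofReal L * hessNorm p fun x => H x - H' x := by
  have hq := one_le_ofReal hp
  have hm : ∀ i j, AEStronglyMeasurable (fun x => |(H x).1 i j - (H' x).1 i j|)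
      (vol (unitBall d)) := fun i j => ((hH i j).1.sub (hH' i j).1).norm
  refine (eLpNorm_le_mul_eLpNorm_of_ae_le_mul (c := L)
    (g := ∑ i, ∑ j, fun x => |(H x).1 i j - (H' x).1 i j|) (ae_of_all _ fun x => ?_) _).trans ?_
  · simp only [Finset.sum_apply, Real.norm_eq_abs]
    refine (hF.lipschitz _ _).trans (le_of_eq ?_)
    rw [abs_of_nonneg (by positivity)]
  · refine mul_le_mul_right ?_ _
    refine (eLpNorm_sum_le (fun i _ => Finset.aestronglyMeasurable_sum _ fun j _ => hm i j)
      hq).trans (Finset.sum_le_sum fun i _ => ?_)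
    refine (eLpNorm_sum_le (fun j _ => hm i j) hq).trans (Finset.sum_le_sum fun j _ => ?_)
    refine le_of_eq ?_
    simp only [← Real.norm_eq_abs]
    rw [eLpNorm_norm]
    rfl

theorem hessNorm_ne_top {H : E d → Sym d}
    (hH : ∀ i j, MemLp (fun x => (H x).1 i j) (ENNReal.ofReal p) (vol (unitBall d))) :
    hessNorm p H ≠ ⊤ := by
  simp only [hessNorm, ENNReal.sum_ne_top]
  exact fun i _ j _ => (hH i j).2.ne

theorem NormLike.memLp_comp (hF : NormLike F c L) (hp : 1 < p) {H : E d → Sym d}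
    (hH : ∀ i j, MemLp (fun x => (H x).1 i j) (ENNReal.ofReal p) (vol (unitBall d))) :
    MemLp (fun x => F (H x)) (ENNReal.ofReal p) (vol (unitBall d)) := by
  refine ⟨hF.aestronglyMeasurable_comp fun i j => (hH i j).1, ?_⟩
  have h := eLpNorm_sub_le_hessNorm hF hp hH (H' := fun _ => 0) fun i j => MemLp.zero' (ε := ℝ)
  simp only [hF.map_zero, sub_zero] at h
  exact h.trans_lt (ENNReal.mul_lt_top ENNReal.ofReal_lt_top (hessNorm_ne_top hH).lt_top)

theorem NormLike.hessNorm_le (hF : NormLike F c L) (H : E d → Sym d) :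
    hessNorm p H ≤ d * (d * (ENNReal.ofReal c *
      eLpNorm (fun x => F (H x)) (ENNReal.ofReal p) (vol (unitBall d)))) := by
  have h1 : ∀ i j, eLpNorm (fun x => (H x).1 i j) (ENNReal.ofReal p) (vol (unitBall d)) ≤
      ENNReal.ofReal c * eLpNorm (fun x => F (H x)) (ENNReal.ofReal p) (vol (unitBall d)) := by
    intro i j
    refine eLpNorm_le_mul_eLpNorm_of_ae_le_mul (ae_of_all _ fun x => ?_) _
    rw [Real.norm_eq_abs, Real.norm_of_nonneg (hF.nonneg _)]
    exact hF.entry_le _ i j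
  refine (Finset.sum_le_card_nsmul _ _ _ fun i _ =>
    (Finset.sum_le_card_nsmul _ _ _ fun j _ => h1 i j)).trans ?_
  simp

/-! ### The energy -/

theorem integrable_abs_rpow (hp : 1 < p) {α : Type*} [MeasurableSpace α] {μ : Measure α}
    {f : α → ℝ} (hf : MemLp f (ENNReal.ofReal p) μ) : Integrable (fun x => |f x| ^ p) μ := by
  have hp0 : 0 < p := by linarith
  have := hf.integrable_norm_rpow (by simpa using hp0) ENNReal.ofReal_ne_top
  rwa [ENNReal.toReal_ofReal hp0.le] at this

theorem eLpNorm_rpow_eq_ofReal_integral (hp : 1 < p) {α : Type*} [MeasurableSpace α]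
    {μ : Measure α} {f : α → ℝ} (hf : MemLp f (ENNReal.ofReal p) μ) :
    eLpNorm f (ENNReal.ofReal p) μ ^ p = ENNReal.ofReal (∫ x, |f x| ^ p ∂μ) := by
  have hp0 : 0 < p := by linarith
  rw [eLpNorm_ofReal_rpow hp, ofReal_integral_eq_lintegral_ofReal (integrable_abs_rpow hp hf)
    (ae_of_all _ fun x => Real.rpow_nonneg (abs_nonneg _) _)]
  refine lintegral_congr fun x => ?_
  rw [← ofReal_norm, ENNReal.ofReal_rpow_of_nonneg (norm_nonneg _) hp0.le, Real.norm_eq_abs]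

/-- Since `min u 0 = u - max u 0`, the lower order term is the sum of a convex and a linear term. -/
theorem density_eq (γp γm : ℝ) (u : E d → ℝ) (x : E d) :
    density F p γp γm u x = F (weakHessian (unitBall d) u x) ^ p +
      ((γp + γm) * max (u x) 0 - γm * u x) := by
  have := min_add_max (u x) 0
  rw [density]
  linear_combination (-γm) * this

theorem NormLike.integrable_hess (hF : NormLike F c L) (hp : 1 < p) {u : E d → ℝ}
    (hu : MemW2p (unitBall d) p u) :
    Integrable (fun x => F (weakHessian (unitBall d) u x) ^ p) (vol (unitBall d)) := by
  obtain ⟨G, h⟩ := hu.exists_sobolevData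
  have := integrable_abs_rpow hp (hF.memLp_comp hp h.memLp_hess)
  simpa only [abs_of_nonneg (hF.nonneg _)] using this

theorem integrable_lowerOrder (hp : 1 < p) (γp γm : ℝ) {u : E d → ℝ}
    (hu : MemW2p (unitBall d) p u) :
    Integrable (fun x => (γp + γm) * max (u x) 0 - γm * u x) (vol (unitBall d)) := by
  have h := hu.memLp.integrable (one_le_ofReal hp)
  exact (h.pos_part.const_mul _).sub (h.const_mul _)

theorem NormLike.integrable_density (hF : NormLike F c L) (hp : 1 < p) (γp γm : ℝ) {u : E d → ℝ}
    (hu : MemW2p (unitBall d) p u) :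
    Integrable (density F p γp γm u) (vol (unitBall d)) := by
  have := (hF.integrable_hess hp hu).add (integrable_lowerOrder hp γp γm hu)
  refine this.congr (ae_of_all _ fun x => ?_)
  rw [density_eq]
  rfl

theorem NormLike.energy_eq (hF : NormLike F c L) (hp : 1 < p) (γp γm : ℝ) {u : E d → ℝ}
    (hu : MemW2p (unitBall d) p u) :
    energy F p γp γm u = ∫ x, F (weakHessian (unitBall d) u x) ^ p ∂(vol (unitBall d)) +
      ∫ x, ((γp + γm) * max (u x) 0 - γm * u x) ∂(vol (unitBall d)) := by
  rw [← integral_add (hF.integrable_hess hp hu) (integrable_lowerOrder hp γp γm hu), energy]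
  simp only [density_eq]
  rfl

theorem MemW2p.weakHessian_linComb_ae_eq {u v : E d → ℝ} (hu : MemW2p (unitBall d) p u)
    (hv : MemW2p (unitBall d) p v) (a b : ℝ) :
    weakHessian (unitBall d) (fun x => a * u x + b * v x) =ᵐ[vol (unitBall d)]
      fun x => a • weakHessian (unitBall d) u x + b • weakHessian (unitBall d) v x := by
  obtain ⟨G, h⟩ := hu.exists_sobolevData
  obtain ⟨G', h'⟩ := hv.exists_sobolevData
  exact (h.linComb h' a b).weakHessian_ae_eq

/-- Midpoint convexity of the energy. The lower order term is convex because `γ₊ + γ₋` is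
positive, even if `γ₋` is negative. -/
theorem NormLike.energy_midpoint_le (hF : NormLike F c L) (hp : 1 < p) {γp γm : ℝ}
    (hγ : 0 < γp + γm) {u v : E d → ℝ} (hu : MemW2p (unitBall d) p u)
    (hv : MemW2p (unitBall d) p v) (hw : MemW2p (unitBall d) p fun x => 1 / 2 * u x + 1 / 2 * v x) :
    energy F p γp γm (fun x => 1 / 2 * u x + 1 / 2 * v x) ≤
      (energy F p γp γm u + energy F p γp γm v) / 2 := by
  have hiu := hF.integrable_density hp γp γm hu
  have hiv := hF.integrable_density hp γp γm hv
  have hiw := hF.integrable_density hp γp γm hw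
  have h1 : (energy F p γp γm u + energy F p γp γm v) / 2 =
      ∫ x, (1 / 2 * density F p γp γm u x + 1 / 2 * density F p γp γm v x) ∂(vol (unitBall d)) := by
    rw [integral_add (hiu.const_mul _) (hiv.const_mul _), integral_const_mul, integral_const_mul,
      energy, energy]
    simp only [vol]
    ring
  rw [h1]
  refine integral_mono_ae hiw ((hiu.const_mul _).add (hiv.const_mul _)) ?_
  filter_upwards [hu.weakHessian_linComb_ae_eq hv (1 / 2) (1 / 2)] with x hx
  simp only [density_eq, hx]
  set A := weakHessian (unitBall d) u x
  set B := weakHessian (unitBall d) v x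
  have e1 : F ((1 / 2 : ℝ) • A + (1 / 2 : ℝ) • B) ≤ 1 / 2 * F A + 1 / 2 * F B :=
    hF.convex.2 (Set.mem_univ _) (Set.mem_univ _) (by norm_num) (by norm_num) (by norm_num)
  have e2 : (1 / 2 * F A + 1 / 2 * F B) ^ p ≤ 1 / 2 * F A ^ p + 1 / 2 * F B ^ p :=
    (convexOn_rpow hp.le).2 (hF.nonneg A) (hF.nonneg B) (by norm_num) (by norm_num) (by norm_num)
  have e3 := Real.rpow_le_rpow (hF.nonneg _) e1 (by linarith : 0 ≤ p)
  have e4 : max (1 / 2 * u x + 1 / 2 * v x) 0 ≤ 1 / 2 * max (u x) 0 + 1 / 2 * max (v x) 0 := by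
    apply max_le
    · linarith [le_max_left (u x) 0, le_max_left (v x) 0]
    · linarith [le_max_right (u x) 0, le_max_right (v x) 0]
  have e5 := mul_le_mul_of_nonneg_left e4 hγ.le
  linarith

/-! ### Coercivity, compactness and lower semicontinuity -/

theorem MemW01p.sub (hp : 1 < p) {v w : E d → ℝ} (hv : MemW01p (unitBall d) p v)
    (hw : MemW01p (unitBall d) p w) : MemW01p (unitBall d) p fun x => v x - w x := by
  simpa [← sub_eq_add_neg] using hv.linComb hp hw 1 (-1)

theorem SobolevData.sub {u v : E d → ℝ} {G G' : E d → E d} {H H' : E d → Sym d}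
    (h : SobolevData p u G H) (h' : SobolevData p v G' H') :
    SobolevData p (fun x => u x - v x) (fun x => G x - G' x) (fun x => H x - H' x) := by
  have e : (fun x => H x - H' x) = fun x => (1 : ℝ) • H x + (-1 : ℝ) • H' x := by
    funext x
    refine Subtype.ext (Matrix.ext fun i j => ?_)
    simp [sub_eq_add_neg]
  rw [e]
  simpa [← sub_eq_add_neg] using h.linComb h' 1 (-1)

theorem hessNorm_sub_le (hp : 1 < p) {H H' : E d → Sym d}
    (hH : ∀ i j, MemLp (fun x => (H x).1 i j) (ENNReal.ofReal p) (vol (unitBall d)))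
    (hH' : ∀ i j, MemLp (fun x => (H' x).1 i j) (ENNReal.ofReal p) (vol (unitBall d))) :
    hessNorm p (fun x => H x - H' x) ≤ hessNorm p H + hessNorm p H' := by
  simp only [hessNorm, ← Finset.sum_add_distrib]
  exact Finset.sum_le_sum fun i _ => Finset.sum_le_sum fun j _ =>
    eLpNorm_sub_le (hH i j).1 (hH' i j).1 (one_le_ofReal hp)

/-- The `L¹` norm of an admissible function grows at most linearly in `‖F(D²u)‖_p`. -/
theorem NormLike.exists_integral_abs_le (hF : NormLike F c L) (hd : 0 < d) (hp : 1 < p)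
    {g : E d → ℝ} (hg : MemW2p (unitBall d) p g) :
    ∃ k₁ k₂ : ℝ, 0 ≤ k₂ ∧ ∀ u, Admissible (unitBall d) p g u →
      ∫ x, |u x| ∂(vol (unitBall d)) ≤ k₁ + k₂ *
        (∫ x, F (weakHessian (unitBall d) u x) ^ p ∂(vol (unitBall d))) ^ (1 / p) := by
  have hp0 : 0 < p := by linarith
  have hq := one_le_ofReal hp
  obtain ⟨C, hC, hCv⟩ := exists_eLpNorm_le_hessNorm hd hp
  obtain ⟨Gg, hgd⟩ := hg.exists_sobolevData
  set q := ENNReal.ofReal p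
  set μ := vol (unitBall d)
  obtain ⟨V, hV, hVle⟩ := exists_eLpNorm_one_le_mul (ε := ℝ) μ hq
  set K₁ := (eLpNorm g q μ + C * hessNorm p (weakHessian (unitBall d) g)) * V
  set K₂ := C * (d * (d * ENNReal.ofReal c)) * V
  have hK₁ : K₁ ≠ ⊤ := ENNReal.mul_ne_top (ENNReal.add_ne_top.2 ⟨hgd.memLp.2.ne,
    ENNReal.mul_ne_top hC (hessNorm_ne_top hgd.memLp_hess)⟩) hV
  have hK₂ : K₂ ≠ ⊤ := ENNReal.mul_ne_top (ENNReal.mul_ne_top hC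
    (ENNReal.mul_ne_top (ENNReal.natCast_ne_top d)
      (ENNReal.mul_ne_top (ENNReal.natCast_ne_top d) ENNReal.ofReal_ne_top))) hV
  refine ⟨K₁.toReal, K₂.toReal, ENNReal.toReal_nonneg, fun u hu => ?_⟩
  obtain ⟨Gu, hud⟩ := hu.1.exists_sobolevData
  have h1 := (hCv _ _ _ (hud.sub hgd) hu.2).1
  set X := (∫ x, F (weakHessian (unitBall d) u x) ^ p ∂μ) ^ (1 / p) with hX
  have hI0 : 0 ≤ ∫ x, F (weakHessian (unitBall d) u x) ^ p ∂μ :=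
    integral_nonneg fun x => Real.rpow_nonneg (hF.nonneg _) _
  have hX0 : 0 ≤ X := Real.rpow_nonneg hI0 _
  have hFX : eLpNorm (fun x => F (weakHessian (unitBall d) u x)) q μ = ENNReal.ofReal X := by
    have h := eLpNorm_rpow_eq_ofReal_integral hp (hF.memLp_comp hp hud.memLp_hess)
    simp only [abs_of_nonneg (hF.nonneg _)] at h
    rw [hX, ← ENNReal.ofReal_rpow_of_nonneg hI0 (by positivity), ← h, ← ENNReal.rpow_mul,
      mul_one_div_cancel hp0.ne', ENNReal.rpow_one]
  have h2 : eLpNorm u q μ ≤ eLpNorm g q μ + eLpNorm (fun x => u x - g x) q μ := by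
    have := eLpNorm_add_le hgd.memLp.1 (hud.memLp.1.sub hgd.memLp.1) hq
    rwa [add_sub_cancel] at this
  have h3 : eLpNorm u 1 μ ≤ K₁ + K₂ * ENNReal.ofReal X := by
    refine (hVle u hud.memLp.1).trans ?_
    have h4 : eLpNorm u q μ ≤ eLpNorm g q μ + C * (d * (d * (ENNReal.ofReal c *
        ENNReal.ofReal X)) + hessNorm p (weakHessian (unitBall d) g)) := by
      refine h2.trans (add_le_add_right (h1.trans (mul_le_mul_right ?_ _)) _)
      refine (hessNorm_sub_le hp hud.memLp_hess hgd.memLp_hess).trans (add_le_add_left ?_ _)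
      rw [← hFX]
      exact hF.hessNorm_le _
    refine (mul_le_mul_left h4 V).trans (le_of_eq ?_)
    simp only [K₁, K₂]
    ring
  have h5 : ENNReal.ofReal (∫ x, |u x| ∂μ) = eLpNorm u 1 μ := by
    rw [eLpNorm_one_eq_lintegral_enorm, ofReal_integral_eq_lintegral_ofReal (f := fun x => |u x|)
      (hud.memLp.integrable hq).norm (ae_of_all _ fun x => abs_nonneg _)]
    exact lintegral_congr fun x => by rw [← ofReal_norm]; rfl
  have h6 : ENNReal.ofReal (∫ x, |u x| ∂μ) ≤
      ENNReal.ofReal (K₁.toReal + K₂.toReal * X) := by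
    rw [h5, ENNReal.ofReal_add ENNReal.toReal_nonneg (by positivity),
      ENNReal.ofReal_mul ENNReal.toReal_nonneg, ENNReal.ofReal_toReal hK₁, ENNReal.ofReal_toReal hK₂]
    exact h3
  exact (ENNReal.ofReal_le_ofReal_iff (by positivity)).1 h6

/-- Coercivity of the energy on admissible functions. -/
theorem NormLike.exists_integral_rpow_le_energy (hF : NormLike F c L) (hd : 0 < d) (hp : 1 < p)
    {γp γm : ℝ} (hγ : 0 < γp + γm) {g : E d → ℝ} (hg : MemW2p (unitBall d) p g) :
    ∃ K : ℝ, ∀ u, Admissible (unitBall d) p g u →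
      ∫ x, F (weakHessian (unitBall d) u x) ^ p ∂(vol (unitBall d)) ≤
        2 * (energy F p γp γm u + K) := by
  have hp0 : 0 < p := by linarith
  obtain ⟨k₁, k₂, hk₂, hk⟩ := hF.exists_integral_abs_le hd hp hg
  obtain ⟨K, hK0, hK⟩ := exists_mul_le_half_rpow_add hp (|γm| * k₂)
  refine ⟨|γm| * k₁ + K, fun u hu => ?_⟩
  set A := ∫ x, F (weakHessian (unitBall d) u x) ^ p ∂(vol (unitBall d)) with hA
  have hA0 : 0 ≤ A := integral_nonneg fun x => Real.rpow_nonneg (hF.nonneg _) _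
  have h1 := hK (A ^ (1 / p)) (by positivity)
  rw [← Real.rpow_mul hA0, one_div_mul_cancel hp0.ne', Real.rpow_one] at h1
  have hui := hu.1.memLp.integrable (one_le_ofReal hp)
  have h2 : -(|γm| * ∫ x, |u x| ∂(vol (unitBall d))) ≤
      ∫ x, ((γp + γm) * max (u x) 0 - γm * u x) ∂(vol (unitBall d)) := by
    rw [← integral_const_mul, ← integral_neg]
    refine integral_mono (hui.norm.const_mul _).neg (integrable_lowerOrder hp γp γm hu.1)
      fun x => ?_
    have e1 : γm * u x ≤ |γm| * |u x| := by
      rw [← abs_mul]; exact le_abs_self _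
    have e2 : 0 ≤ (γp + γm) * max (u x) 0 := mul_nonneg hγ.le (le_max_right _ _)
    show -(|γm| * |u x|) ≤ _
    linarith
  have h3 := hF.energy_eq hp γp γm hu.1
  have h4 := mul_le_mul_of_nonneg_left (hk u hu) (abs_nonneg γm)
  rw [← hA] at h3 h4
  have h5 : |γm| * (k₁ + k₂ * A ^ (1 / p)) = |γm| * k₁ + |γm| * k₂ * A ^ (1 / p) := by ring
  linarith

/-- The sum of the `p`-th powers of the `L^p` norms of the entries of a matrix valued function. -/
noncomputable def hessPow (p : ℝ) (H : E d → Sym d) : ℝ :=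
  ∑ i, ∑ j, ∫ x, |(H x).1 i j| ^ p ∂(vol (unitBall d))

theorem hessPow_nonneg (H : E d → Sym d) : 0 ≤ hessPow p H :=
  Finset.sum_nonneg fun _ _ => Finset.sum_nonneg fun _ _ =>
    integral_nonneg fun _ => Real.rpow_nonneg (abs_nonneg _) _

theorem hessPow_congr {H H' : E d → Sym d} (h : H =ᵐ[vol (unitBall d)] H') :
    hessPow p H = hessPow p H' := by
  refine Finset.sum_congr rfl fun i _ => Finset.sum_congr rfl fun j _ => integral_congr_ae ?_
  filter_upwards [h] with x hx
  rw [hx]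

theorem hessNorm_le_hessPow (hp : 1 < p) {H : E d → Sym d}
    (hH : ∀ i j, MemLp (fun x => (H x).1 i j) (ENNReal.ofReal p) (vol (unitBall d))) :
    hessNorm p H ≤ d * (d * ENNReal.ofReal (hessPow p H) ^ (1 / p)) := by
  have hp0 : 0 < p := by linarith
  have h1 : ∀ i j, eLpNorm (fun x => (H x).1 i j) (ENNReal.ofReal p) (vol (unitBall d)) ≤
      ENNReal.ofReal (hessPow p H) ^ (1 / p) := by
    intro i j
    rw [one_div, ENNReal.le_rpow_inv_iff hp0, eLpNorm_rpow_eq_ofReal_integral hp (hH i j)]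
    refine ENNReal.ofReal_le_ofReal ?_
    have hnn : ∀ i j, 0 ≤ ∫ x, |(H x).1 i j| ^ p ∂(vol (unitBall d)) := fun i j =>
      integral_nonneg fun _ => Real.rpow_nonneg (abs_nonneg _) _
    exact (Finset.single_le_sum (fun j _ => hnn i j) (Finset.mem_univ j)).trans
      (Finset.single_le_sum (f := fun i => ∑ j, ∫ x, |(H x).1 i j| ^ p ∂(vol (unitBall d)))
        (fun i _ => Finset.sum_nonneg fun j _ => hnn i j) (Finset.mem_univ i))
  refine (Finset.sum_le_card_nsmul _ _ _ fun i _ =>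
    (Finset.sum_le_card_nsmul _ _ _ fun j _ => h1 i j)).trans ?_
  simp

theorem NormLike.hessPow_le (hF : NormLike F c L) (hp : 1 < p) (hc : 0 ≤ c) {H : E d → Sym d}
    (hH : ∀ i j, MemLp (fun x => (H x).1 i j) (ENNReal.ofReal p) (vol (unitBall d))) :
    hessPow p H ≤ d * (d * (c ^ p * ∫ x, F (H x) ^ p ∂(vol (unitBall d)))) := by
  have hp0 : 0 < p := by linarith
  have hi := integrable_abs_rpow hp (hF.memLp_comp hp hH)
  simp only [abs_of_nonneg (hF.nonneg _)] at hi
  have h1 : ∀ i j, ∫ x, |(H x).1 i j| ^ p ∂(vol (unitBall d)) ≤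
      c ^ p * ∫ x, F (H x) ^ p ∂(vol (unitBall d)) := by
    intro i j
    rw [← integral_const_mul]
    refine integral_mono (integrable_abs_rpow hp (hH i j)) (hi.const_mul _) fun x => ?_
    show |(H x).1 i j| ^ p ≤ c ^ p * F (H x) ^ p
    rw [← Real.mul_rpow hc (hF.nonneg _)]
    exact Real.rpow_le_rpow (abs_nonneg _) (hF.entry_le _ i j) hp0.le
  refine (Finset.sum_le_card_nsmul _ _ _ fun i _ =>
    (Finset.sum_le_card_nsmul _ _ _ fun j _ => h1 i j)).trans ?_
  simp

theorem exists_hessPow_sub_le (hp : 1 < p) {ε : ℝ} (hε : 0 < ε) :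
    ∃ C : ℝ, 0 ≤ C ∧ ∀ H H' : E d → Sym d,
      (∀ i j, MemLp (fun x => (H x).1 i j) (ENNReal.ofReal p) (vol (unitBall d))) →
      (∀ i j, MemLp (fun x => (H' x).1 i j) (ENNReal.ofReal p) (vol (unitBall d))) →
      hessPow p (fun x => H x - H' x) ≤ ε * (hessPow p H + hessPow p H') +
        C * ((hessPow p H + hessPow p H') / 2 -
          hessPow p fun x => (1 / 2 : ℝ) • H x + (1 / 2 : ℝ) • H' x) := by
  obtain ⟨C, hC0, hC⟩ := exists_abs_sub_rpow_le hp hε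
  refine ⟨C, hC0, fun H H' hH hH' => ?_⟩
  have hij : ∀ i j, ∫ x, |(H x - H' x).1 i j| ^ p ∂(vol (unitBall d)) ≤
      ε * (∫ x, |(H x).1 i j| ^ p ∂(vol (unitBall d)) +
        ∫ x, |(H' x).1 i j| ^ p ∂(vol (unitBall d))) +
      C * ((∫ x, |(H x).1 i j| ^ p ∂(vol (unitBall d)) +
        ∫ x, |(H' x).1 i j| ^ p ∂(vol (unitBall d))) / 2 -
        ∫ x, |((1 / 2 : ℝ) • H x + (1 / 2 : ℝ) • H' x).1 i j| ^ p ∂(vol (unitBall d))) := by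
    intro i j
    have e : ∀ x, ((1 / 2 : ℝ) • H x + (1 / 2 : ℝ) • H' x).1 i j =
        ((H x).1 i j + (H' x).1 i j) / 2 := fun x => by
      simp only [Submodule.coe_add, Submodule.coe_smul, Matrix.add_apply, Matrix.smul_apply,
        smul_eq_mul]
      ring
    have hm : MemLp (fun x => ((H x).1 i j + (H' x).1 i j) / 2) (ENNReal.ofReal p)
        (vol (unitBall d)) := by
      refine (((hH i j).add (hH' i j)).const_mul (1 / 2)).ae_eq (ae_of_all _ fun x => ?_)
      simp only [Pi.add_apply]; ring
    have i1 := integrable_abs_rpow hp (hH i j)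
    have i2 := integrable_abs_rpow hp (hH' i j)
    have i3 := integrable_abs_rpow hp hm
    have i4 : Integrable (fun x => |(H x - H' x).1 i j| ^ p) (vol (unitBall d)) :=
      integrable_abs_rpow hp ((hH i j).sub (hH' i j))
    simp only [e]
    rw [← integral_add i1 i2, ← integral_const_mul, ← integral_div, ← integral_sub _ i3,
      ← integral_const_mul, ← integral_add]
    · exact integral_mono i4 (((i1.add i2).const_mul _).add
        ((((i1.add i2).div_const _).sub i3).const_mul _)) fun x => hC _ _
    · exact (i1.add i2).const_mul _
    · exact (((i1.add i2).div_const _).sub i3).const_mul _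
    · exact (i1.add i2).div_const _
  refine (Finset.sum_le_sum fun i _ => Finset.sum_le_sum fun j _ => hij i j).trans (le_of_eq ?_)
  simp only [hessPow, Finset.sum_add_distrib, ← Finset.mul_sum, Finset.sum_sub_distrib,
    ← Finset.sum_div]

/-- Uniform convexity of `L^p` in the form used here: a bounded sequence whose midpoints show no
gap asymptotically is Cauchy. -/
theorem tendsto_hessNorm_sub (hp : 1 < p) {H : ℕ → E d → Sym d}
    (hH : ∀ n i j, MemLp (fun x => (H n x).1 i j) (ENNReal.ofReal p) (vol (unitBall d)))
    {R : ℝ} (hR : ∀ n, hessPow p (H n) ≤ R)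
    (hgap : ∀ ε > 0, ∃ k, ∀ n ≥ k, ∀ m ≥ k, (hessPow p (H n) + hessPow p (H m)) / 2 -
      hessPow p (fun x => (1 / 2 : ℝ) • H n x + (1 / 2 : ℝ) • H m x) < ε) :
    Tendsto (fun k : ℕ × ℕ => hessNorm p fun x => H k.1 x - H k.2 x) atTop (𝓝 0) := by
  have hp0 : 0 < p := by linarith
  have hR0 : 0 ≤ R := (hessPow_nonneg _).trans (hR 0)
  have h1 : Tendsto (fun k : ℕ × ℕ => hessPow p fun x => H k.1 x - H k.2 x) atTop (𝓝 0) := by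
    rw [Metric.tendsto_atTop]
    intro ε hε
    set η := ε / (4 * (R + 1)) with hη
    have hη0 : 0 < η := by positivity
    obtain ⟨C, hC0, hC⟩ := exists_hessPow_sub_le (d := d) hp hη0
    obtain ⟨k, hk⟩ := hgap (ε / (2 * (C + 1))) (by positivity)
    refine ⟨(k, k), fun m hm => ?_⟩
    rw [Real.dist_eq, sub_zero, abs_of_nonneg (hessPow_nonneg _)]
    refine (hC _ _ (hH m.1) (hH m.2)).trans_lt ?_
    have e1 : η * (hessPow p (H m.1) + hessPow p (H m.2)) ≤ η * (R + R) :=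
      mul_le_mul_of_nonneg_left (add_le_add (hR _) (hR _)) hη0.le
    have e2 : η * (R + R) < ε / 2 := by
      have h : η * (4 * (R + 1)) = ε := div_mul_cancel₀ _ (by positivity)
      have : η * (R + R) = (ε - 4 * η) / 2 := by rw [← h]; ring
      linarith
    have e3 := mul_le_mul_of_nonneg_left (hk m.1 hm.1 m.2 hm.2).le hC0
    have e4 : C * (ε / (2 * (C + 1))) ≤ ε / 2 := by
      rw [mul_div_assoc', div_le_div_iff₀ (by positivity) two_pos]
      nlinarith
    linarith
  have h2 : Tendsto (fun k : ℕ × ℕ => (d : ℝ≥0∞) * (d * ENNReal.ofReal (hessPow p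
      fun x => H k.1 x - H k.2 x) ^ (1 / p))) atTop (𝓝 (d * (d * 0 ^ (1 / p)))) := by
    have h3 := (ENNReal.tendsto_ofReal h1).ennrpow_const (1 / p)
    rw [ENNReal.ofReal_zero] at h3
    exact ENNReal.Tendsto.const_mul (ENNReal.Tendsto.const_mul h3
      (Or.inr (ENNReal.natCast_ne_top d))) (Or.inr (ENNReal.natCast_ne_top d))
  rw [ENNReal.zero_rpow_of_pos (by positivity), mul_zero, mul_zero] at h2
  exact tendsto_of_tendsto_of_tendsto_of_le_of_le tendsto_const_nhds h2 (fun _ => zero_le)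
    fun k => hessNorm_le_hessPow hp fun i j => (hH k.1 i j).sub (hH k.2 i j)

theorem tendsto_zero_of_le_const_mul {ι : Type*} {l : Filter ι} {f : ι → ℝ≥0∞} {K : ℝ≥0∞} (hK : K ≠ ⊤)
    {e : ι → ℝ≥0∞} (h : Tendsto e l (𝓝 0)) (hf : ∀ n, f n ≤ K * e n) : Tendsto f l (𝓝 0) := by
  have := ENNReal.Tendsto.const_mul h (Or.inr hK)
  rw [mul_zero] at this
  exact tendsto_of_tendsto_of_tendsto_of_le_of_le tendsto_const_nhds this (fun _ => zero_le) hf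

/-- Completeness of the set of admissible functions: if the Hessians of a sequence are Cauchy
in `L^p`, then the second order Poincaré inequality, applied to differences, yields a limit. -/
theorem exists_admissible_limit (hd : 0 < d) (hp : 1 < p) {g : E d → ℝ}
    (hg : MemW2p (unitBall d) p g) {u : ℕ → E d → ℝ}
    (hu : ∀ n, Admissible (unitBall d) p g (u n))
    (hc : Tendsto (fun k : ℕ × ℕ => hessNorm p fun x => weakHessian (unitBall d) (u k.1) x -
      weakHessian (unitBall d) (u k.2) x) atTop (𝓝 0)) :
    ∃ u', Admissible (unitBall d) p g u' ∧
      Tendsto (fun n => eLpNorm (fun x => u n x - u' x) (ENNReal.ofReal p) (vol (unitBall d)))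
        atTop (𝓝 0) ∧
      Tendsto (fun n => hessNorm p fun x => weakHessian (unitBall d) (u n) x -
        weakHessian (unitBall d) u' x) atTop (𝓝 0) := by
  have hq := one_le_ofReal hp
  obtain ⟨C, hC, hCv⟩ := exists_eLpNorm_le_hessNorm hd hp
  obtain ⟨Gg, hgd⟩ := hg.exists_sobolevData
  have hex := fun n => (hu n).1.exists_sobolevData
  choose G hG using hex
  have hW : ∀ n m, MemW01p (unitBall d) p fun x => u n x - u m x := fun n m => by
    have := (hu n).2.sub hp (hu m).2
    simpa only [sub_sub_sub_cancel_right] using this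
  have hK := fun k : ℕ × ℕ => hCv _ _ _ ((hG k.1).sub (hG k.2)) (hW k.1 k.2)
  obtain ⟨u', hu'p, hu't⟩ := exists_tendsto_eLpNorm_of_cauchy hq (fun n => (hG n).memLp)
    (tendsto_zero_of_le_const_mul hC hc fun k => (hK k).1)
  obtain ⟨G', hG'p, hG't⟩ := exists_tendsto_eLpNorm_of_cauchy hq (fun n => (hG n).memLp_grad)
    (tendsto_zero_of_le_const_mul hC hc fun k => (hK k).2)
  have hent : ∀ i j, ∃ h : E d → ℝ, MemLp h (ENNReal.ofReal p) (vol (unitBall d)) ∧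
      Tendsto (fun n => eLpNorm (fun x => (weakHessian (unitBall d) (u n) x).1 i j - h x)
        (ENNReal.ofReal p) (vol (unitBall d))) atTop (𝓝 0) := fun i j =>
    exists_tendsto_eLpNorm_of_cauchy hq (fun n => (hG n).memLp_hess i j)
      (tendsto_of_tendsto_of_tendsto_of_le_of_le tendsto_const_nhds hc (fun _ => zero_le)
        fun k => eLpNorm_le_hessNorm (fun x => weakHessian (unitBall d) (u k.1) x -
          weakHessian (unitBall d) (u k.2) x) i j)
  choose h hhp hht using hent
  -- Ordering the indices makes the limit of the Hessians symmetric at every point.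
  let H' : E d → Sym d := fun x => ⟨Matrix.of fun i j => h (min i j) (max i j) x, by
    ext i j
    simp [min_comm, max_comm]⟩
  have hsymm : ∀ (M : Sym d) i j, M.1 (min i j) (max i j) = M.1 i j := by
    intro M i j
    rcases le_total i j with hij | hij
    · rw [min_eq_left hij, max_eq_right hij]
    · rw [min_eq_right hij, max_eq_left hij]
      exact M.2.apply i j
  have hH'p : ∀ i j, MemLp (fun x => (H' x).1 i j) (ENNReal.ofReal p) (vol (unitBall d)) :=
    fun i j => hhp _ _
  have hH't : ∀ i j, Tendsto (fun n => eLpNorm (fun x => (weakHessian (unitBall d) (u n) x).1 i j -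
      (H' x).1 i j) (ENNReal.ofReal p) (vol (unitBall d))) atTop (𝓝 0) := by
    intro i j
    refine (hht (min i j) (max i j)).congr fun n => ?_
    simp only [hsymm]
    rfl
  have hdata : SobolevData p u' G' H' :=
    SobolevData.of_tendsto hp hG hu'p hG'p hH'p hu't hG't hH't
  have hdg := hdata.sub hgd
  refine ⟨u', ⟨hdata.memW2p, ?_⟩, hu't, ?_⟩
  · refine MemW01p.of_tendsto hp (fun n => (hu n).2) (fun n => ((hG n).sub hgd).grad)
      (fun n => ((hG n).sub hgd).memLp) (fun n => ((hG n).sub hgd).memLp_grad) hdg.grad hdg.memLp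
      hdg.memLp_grad ?_ ?_
    · simpa only [sub_sub_sub_cancel_right] using hu't
    · simpa only [sub_sub_sub_cancel_right] using hG't
  · have h1 : Tendsto (fun n => hessNorm p fun x => weakHessian (unitBall d) (u n) x - H' x)
        atTop (𝓝 0) := by
      have := tendsto_finsetSum Finset.univ fun i (_ : i ∈ Finset.univ) =>
        tendsto_finsetSum Finset.univ fun j (_ : j ∈ Finset.univ) => hH't i j
      simp only [Finset.sum_const_zero] at this
      exact this
    refine h1.congr fun n => ?_
    refine Finset.sum_congr rfl fun i _ => Finset.sum_congr rfl fun j _ => eLpNorm_congr_ae ?_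
    filter_upwards [hdata.weakHessian_ae_eq] with x hx
    rw [hx]

theorem tendsto_integral_lowerOrder (hp : 1 < p) (γp γm : ℝ) {u : ℕ → E d → ℝ} {u' : E d → ℝ}
    (hu : ∀ n, MemW2p (unitBall d) p (u n)) (hu' : MemW2p (unitBall d) p u')
    (h : Tendsto (fun n => eLpNorm (fun x => u n x - u' x) (ENNReal.ofReal p)
      (vol (unitBall d))) atTop (𝓝 0)) :
    Tendsto (fun n => ∫ x, ((γp + γm) * max (u n x) 0 - γm * u n x) ∂(vol (unitBall d))) atTop
      (𝓝 (∫ x, ((γp + γm) * max (u' x) 0 - γm * u' x) ∂(vol (unitBall d)))) := by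
  have hq := one_le_ofReal hp
  have hi : ∀ {v : E d → ℝ}, MemW2p (unitBall d) p v →
      ∫ x, ((γp + γm) * max (v x) 0 - γm * v x) ∂(vol (unitBall d)) =
        (γp + γm) * ∫ x, max (v x) 0 * 1 ∂(vol (unitBall d)) -
          γm * ∫ x, v x * 1 ∂(vol (unitBall d)) := by
    intro v hv
    have hvi := hv.memLp.integrable hq
    simp only [mul_one]
    rw [integral_sub (hvi.pos_part.const_mul _) (hvi.const_mul _), integral_const_mul,
      integral_const_mul]
  have hmax : ∀ {v : E d → ℝ}, MemW2p (unitBall d) p v →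
      MemLp (fun x => max (v x) 0) (ENNReal.ofReal p) (vol (unitBall d)) := fun hv =>
    hv.memLp.pos_part
  simp only [hi hu', hi (hu _)]
  refine (Tendsto.const_mul _ ?_).sub (Tendsto.const_mul _ ?_)
  · refine tendsto_integral_mul_of_tendsto_eLpNorm hq (fun n => hmax (hu n)) (hmax hu') ?_
      aestronglyMeasurable_const (M := 1) (fun _ => by simp)
    refine tendsto_of_tendsto_of_tendsto_of_le_of_le tendsto_const_nhds h (fun _ => zero_le)
      fun n => eLpNorm_mono fun x => ?_
    exact abs_max_sub_max_le_abs _ _ _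
  · exact tendsto_integral_mul_of_tendsto_eLpNorm hq (fun n => (hu n).memLp) hu'.memLp h
      aestronglyMeasurable_const (M := 1) (fun _ => by simp)

/-- Lower semicontinuity of the energy under strong convergence. -/
theorem NormLike.energy_le_of_tendsto (hF : NormLike F c L) (hp : 1 < p) {γp γm : ℝ}
    {u : ℕ → E d → ℝ} {u' : E d → ℝ}
    (hu : ∀ n, MemW2p (unitBall d) p (u n)) (hu' : MemW2p (unitBall d) p u')
    (h : Tendsto (fun n => eLpNorm (fun x => u n x - u' x) (ENNReal.ofReal p)
      (vol (unitBall d))) atTop (𝓝 0))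
    (hH : Tendsto (fun n => hessNorm p fun x => weakHessian (unitBall d) (u n) x -
        weakHessian (unitBall d) u' x) atTop (𝓝 0))
    {m : ℝ} (hm : Tendsto (fun n => energy F p γp γm (u n)) atTop (𝓝 m)) :
    energy F p γp γm u' ≤ m := by
  have hp0 : 0 < p := by linarith
  have hq := one_le_ofReal hp
  have hex := fun n => (hu n).exists_sobolevData
  choose G hG using hex
  obtain ⟨G', hG'⟩ := hu'.exists_sobolevData
  set l := ∫ x, ((γp + γm) * max (u' x) 0 - γm * u' x) ∂(vol (unitBall d)) with hl
  set A : (E d → ℝ) → ℝ := fun v =>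
    ∫ x, F (weakHessian (unitBall d) v x) ^ p ∂(vol (unitBall d)) with hA
  have hA0 : ∀ v, 0 ≤ A v := fun v => integral_nonneg fun x => Real.rpow_nonneg (hF.nonneg _) _
  -- The lower order terms converge, so the leading terms have the limit `m - l`.
  have hAt : Tendsto (fun n => A (u n)) atTop (𝓝 (m - l)) := by
    refine (hm.sub (tendsto_integral_lowerOrder hp γp γm hu hu' h)).congr fun n => ?_
    rw [hF.energy_eq hp γp γm (hu n)]
    simp [hA]
  have hAe : ∀ {v : E d → ℝ} {K : E d → E d}, SobolevData p v K (weakHessian (unitBall d) v) →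
      eLpNorm (fun x => F (weakHessian (unitBall d) v x)) (ENNReal.ofReal p) (vol (unitBall d)) ^ p
        = ENNReal.ofReal (A v) := by
    intro v K hv
    have := eLpNorm_rpow_eq_ofReal_integral hp (hF.memLp_comp hp hv.memLp_hess)
    simpa only [abs_of_nonneg (hF.nonneg _)] using this
  have hAe' : ∀ n, eLpNorm (fun x => F (weakHessian (unitBall d) (u n) x)) (ENNReal.ofReal p)
      (vol (unitBall d)) = ENNReal.ofReal (A (u n)) ^ (1 / p) := fun n => by
    rw [← hAe (hG n), ← ENNReal.rpow_mul, mul_one_div_cancel hp0.ne', ENNReal.rpow_one]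
  have hdiff : Tendsto (fun n => eLpNorm (fun x => F (weakHessian (unitBall d) (u n) x) -
      F (weakHessian (unitBall d) u' x)) (ENNReal.ofReal p) (vol (unitBall d))) atTop (𝓝 0) :=
    tendsto_zero_of_le_const_mul ENNReal.ofReal_ne_top hH fun n =>
      eLpNorm_sub_le_hessNorm hF hp (hG n).memLp_hess hG'.memLp_hess
  have hlim := ((ENNReal.tendsto_ofReal hAt).ennrpow_const (1 / p)).add hdiff
  rw [add_zero] at hlim
  have hle : eLpNorm (fun x => F (weakHessian (unitBall d) u' x)) (ENNReal.ofReal p)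
      (vol (unitBall d)) ≤ ENNReal.ofReal (m - l) ^ (1 / p) := by
    refine ge_of_tendsto' hlim fun n => ?_
    have m1 := (hF.memLp_comp hp (hG n).memLp_hess).1
    have := eLpNorm_sub_le m1 (m1.sub (hF.memLp_comp hp hG'.memLp_hess).1) hq
    rw [sub_sub_cancel] at this
    rw [← hAe']
    exact this
  rw [one_div, ENNReal.le_rpow_inv_iff hp0, hAe hG',
    ENNReal.ofReal_le_ofReal_iff (ge_of_tendsto' hAt fun n => hA0 _)] at hle
  rw [hF.energy_eq hp γp γm hu']
  show A u' + l ≤ m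
  linarith

theorem admissible_self {g : E d → ℝ} (hg : MemW2p (unitBall d) p g) :
    Admissible (unitBall d) p g g := by
  obtain ⟨G, h⟩ := hg.exists_sobolevData
  have h0 := h.sub h
  simp only [sub_self] at h0
  refine ⟨hg, fun _ => 0, by simp, by simpa using h0.grad, by simp, fun _ _ => 0,
    fun _ => ⟨contDiff_const, HasCompactSupport.zero, by simp [tsupport]⟩, by simp, ?_⟩
  have : ∀ x : E d, gradient (fun _ : E d => (0 : ℝ)) x = 0 := fun x => gradient_const x 0
  simp [this]

theorem Admissible.midpoint (hp : 1 < p) {g u v : E d → ℝ} (hu : Admissible (unitBall d) p g u)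
    (hv : Admissible (unitBall d) p g v) :
    Admissible (unitBall d) p g fun x => 1 / 2 * u x + 1 / 2 * v x := by
  obtain ⟨G, h⟩ := hu.1.exists_sobolevData
  obtain ⟨G', h'⟩ := hv.1.exists_sobolevData
  refine ⟨(h.linComb h' _ _).memW2p, ?_⟩
  have := hu.2.linComb hp hv.2 (1 / 2) (1 / 2)
  refine (congrArg (MemW01p (unitBall d) p) (funext fun x => ?_)).mp this
  ring

end HessianMin

theorem mainTheorem4 (d : ℕ) (hd : 0 < d) (p : ℝ) (hp : 1 < p)
    (γp γm : ℝ) (hγp : 0 ≤ γp) (hγ : 0 < γp + γm)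
    (F : HessianMin.Sym d → ℝ) (hconv : ConvexOn ℝ Set.univ F)
    (lam Lam : ℝ) (hlam : 0 < lam) (hle : lam ≤ Lam)
    (hgrowth : ∀ M : HessianMin.Sym d,
      lam * HessianMin.opNorm M ≤ F M ∧ F M ≤ Lam * HessianMin.opNorm M)
    (g : HessianMin.E d → ℝ) (hg : HessianMin.MemW2p (HessianMin.unitBall d) p g)
    (hg_nonneg : ∀ᵐ x ∂(volume.restrict (HessianMin.unitBall d)), 0 ≤ g x) :
    (∀ u : HessianMin.E d → ℝ, HessianMin.Admissible (HessianMin.unitBall d) p g u →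
      IntegrableOn (HessianMin.density F p γp γm u) (HessianMin.unitBall d)) ∧
    ∃ uStar : HessianMin.E d → ℝ,
      HessianMin.Admissible (HessianMin.unitBall d) p g uStar ∧
      ∀ u : HessianMin.E d → ℝ, HessianMin.Admissible (HessianMin.unitBall d) p g u →
        HessianMin.energy F p γp γm uStar ≤ HessianMin.energy F p γp γm u := by
  open HessianMin in
  have hF := NormLike.of_growth hconv hlam hle hgrowth
  have hc : 0 ≤ lam⁻¹ := inv_nonneg.2 hlam.le
  refine ⟨fun u hu => hF.integrable_density hp γp γm hu.1, ?_⟩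
  let X := {u : E d → ℝ // Admissible (unitBall d) p g u}
  have : Nonempty X := ⟨⟨g, admissible_self hg⟩⟩
  let mid : X → X → X := fun u v => ⟨_, u.2.midpoint hp v.2⟩
  obtain ⟨K, hK⟩ := hF.exists_integral_rpow_le_energy hd hp hγ hg
  have hbdd : BddBelow (Set.range fun u : X => energy F p γp γm u.1) := by
    refine ⟨-K, ?_⟩
    rintro _ ⟨u, rfl⟩
    have h1 := hK u.1 u.2
    have h2 : 0 ≤ ∫ x, F (weakHessian (unitBall d) u.1 x) ^ p ∂(vol (unitBall d)) :=
      integral_nonneg fun x => Real.rpow_nonneg (hF.nonneg _) _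
    show -K ≤ energy F p γp γm u.1
    linarith
  have hcoer : ∀ a, ∃ R, ∀ u : X, energy F p γp γm u.1 ≤ a →
      hessPow p (weakHessian (unitBall d) u.1) ≤ R := by
    intro a
    refine ⟨d * (d * (lam⁻¹ ^ p * (2 * (a + K)))), fun u hu => ?_⟩
    obtain ⟨G, hG⟩ := u.2.1.exists_sobolevData
    refine (hF.hessPow_le hp hc hG.memLp_hess).trans ?_
    have := hK u.1 u.2
    gcongr
    linarith
  obtain ⟨u, hut, hgap⟩ := exists_minimizing_seq_midpoint_gap mid
    (fun u : X => energy F p γp γm u.1) (fun u : X => hessPow p (weakHessian (unitBall d) u.1))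
    (fun u v => hF.energy_midpoint_le hp hγ u.2.1 v.2.1 (mid u v).2.1) hbdd
    (fun u => hessPow_nonneg _) hcoer
  have hex := fun n => (u n).2.1.exists_sobolevData
  choose G hG using hex
  obtain ⟨a, ha⟩ := hut.bddAbove_range
  obtain ⟨R, hR⟩ := hcoer a
  have hcauchy := tendsto_hessNorm_sub hp (H := fun n => weakHessian (unitBall d) (u n).1)
    (fun n => (hG n).memLp_hess) (fun n => hR (u n) (ha ⟨n, rfl⟩)) (by
      intro ε hε
      obtain ⟨k, hk⟩ := hgap ε hε
      refine ⟨k, fun n hn m hm => ?_⟩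
      rw [← hessPow_congr ((u n).2.1.weakHessian_linComb_ae_eq (u m).2.1 (1 / 2) (1 / 2))]
      exact hk n hn m hm)
  obtain ⟨u', hu', h1, h2⟩ := exists_admissible_limit hd hp hg (fun n => (u n).2) hcauchy
  refine ⟨u', hu', fun w hw => ?_⟩
  exact (hF.energy_le_of_tendsto hp (fun n => (u n).2.1) hu'.1 h1 h2 hut).trans
    (ciInf_le hbdd (⟨w, hw⟩ : X))
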